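/- **Setting.** Finitely many qudits (site $x$ carrying $\mathbb C^{d_x}$) are located at points of $\mathbb R^2$; $D_\rho$ is the closed disk of radius $\rho>L$ about the origin (the "plane of radius $>L$"). An operator is supported on a region if it acts as the identity on the qudits outside it. The annulus of radius $r$ and thickness $t$ about $c$ is $A_t=\{p: r-t\le|p-c|\le r+t\}$. *Hamiltonians.* $H=-\sum_j h_j$ is a finite sum of commuting projectors $h_j$. It has interaction range $w\ge 0$ if every $h_j$ is supported on a disk of diameter $w$. The unit vector $|\psi\rangle$ is an unfrustrated ground state if $h_j|\psi\rangle=|\psi\rangle$ for all $j$. $H$ has *local topological order* (with respect to $|\psi\rangle$) if for every closed disk $D\subseteq D_\rho$, every unit vector $|\phi\rangle$ with $h_j|\phi\rangle=|\phi\rangle$ for all $h_j$ acting nontrivially on $D$ has the same reduced density matrix on $D$ as $|\psi\rangle$. *Logical algebras.* $\mathcal A_t^H$ is the $*$-algebra of the operators supported on $A_t$ that commute with all $h_j$, and $\mathcal N_t^H\subseteq\mathcal A_t^H$ is the two-sided ideal of those that are finite sums $O_1+\dots+O_n$ of operators such that for each $i$ some term $h_j$ supported on $A_{t+w}$ satisfies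 $h_jO_i=O_ih_j=0$. The logical algebra is the finite-dimensional $C^*$-algebra $\mathcal A_t^H/\mathcal N_t^H$. $H$ satisfies the *stable logical algebra condition* on the annuli about $c$ if the inclusion $\mathcal A_t^H\subseteq\mathcal A_{t'}^H$ induces an isomorphism $\mathcal A_t^H/\mathcal N_t^H\to\mathcal A_{t'}^H/\mathcal N_{t'}^H$ whenever $0<t$ and $10w\le t\le t'\le r_{\rm ann}/10$. *Twist pairing.* Fix a left and a right annulus of radius $r_{\rm ann}$, with centers $c_L,c_R$ such that $\frac12 r_{\rm ann}\le|c_L-c_R|\le\frac32 r_{\rm ann}$, both disks of radius $\frac{11}{10}r_{\rm ann}$ about $c_L,c_R$ being contained in $D_\rho$. Let $M$ be the set of sites above the line through $c_L$ and $c_R$, and $M'$ its complement. The twist product of $P=\sum_jP_M^j\otimes P_{M'}^j$ and $Q=\sum_kQ_M^k\otimes Q_{M'}^k$ is $P\infty Q=\sum_{j,k}P_M^jQ_M^k\otimes Q_{M'}^kP_{M'}^j$, and the twist pairing is $\langle\psi|P\infty Q|\psi\rangle$, for $P$ on the left and $Q$ on the right annulus. The fundamental projectors $\pi_a$ of a finite-dimensional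 $C^*$-algebra $\mathcal C$ are the central projectors for which $\pi_a\mathcal C$ is simple, and $\tilde S_{ab}=\langle\psi|\pi_a\infty\pi_b|\psi\rangle$ (computed with representatives) for the fundamental projectors $\pi_a,\pi_b$ of the logical algebras on the left and on the right annulus. Call $H$ *admissible* for $|\psi\rangle$ with range $w$ if it is a commuting projector Hamiltonian of interaction range $w$ with unfrustrated ground state $|\psi\rangle$ that satisfies the local topological order condition and the stable logical algebra condition for both annuli. *Circuits.* A local quantum circuit $W$ is an ordered product of layers, each a product of unitaries with disjoint supports, each acting on at most two qudits at distance at most $1$. It has range at most $R$, where $R\ge 0$, if for every disk $B(c,s)$ and every $O$ supported on it, $WOW^\dagger$ is supported on $B(c,s+R)$. **Theorem.** Let $60t<r_{\rm ann}<L$. 1. If $H_1,H_2$ are admissible for the same state $|\psi\rangle$ with ranges $w_1,w_2$ such that $1200w_i<60t$, then there are $*$-isomorphisms $\Phi_L,\Phi_R$ from $\mathcal A_t^{H_1}/\mathcal N_t^{H_1}$ onto $\mathcal A_t^{H_2}/\mathcal N_t^{H_2}$, on the left and on the right annulus, that preserve the twist pairing: if $P_1,P_2$ represent a class and its image under $\Phi_L$,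 and $Q_1,Q_2$ a class and its image under $\Phi_R$, then $\langle\psi|P_1\infty Q_1|\psi\rangle=\langle\psi|P_2\infty Q_2|\psi\rangle$. The matrices $\tilde S$ of $H_1$ and $H_2$ agree up to permutations of rows and columns. Thus the logical algebra, its twist pairing and $\tilde S$ are determined by $|\psi\rangle$. 2. Let $W$ be a local quantum circuit of range at most $R<t$, and let $H$ be admissible for $|\psi\rangle$ with range $w$, $1200w<60t$. - (a) If $H'$ is admissible for $W|\psi\rangle$ with range $w'$, $1200w'<60t$, then there are $*$-isomorphisms from $\mathcal A_t^{H}/\mathcal N_t^{H}$ onto $\mathcal A_t^{H'}/\mathcal N_t^{H'}$ on both annuli that carry the twist pairing in $|\psi\rangle$ to that in $W|\psi\rangle$, and the two matrices $\tilde S$ agree up to permutations of rows and columns. - (b) $WHW^\dagger=-\sum_jWh_jW^\dagger$ is a commuting projector Hamiltonian of interaction range $w+2R$ with unfrustrated ground state $W|\psi\rangle$, and $O\mapsto WOW^\dagger$ induces $*$-isomorphisms from $\mathcal A_t^{H}/\mathcal N_t^{H}$ onto $\mathcal A_{t+R}^{WHW^\dagger}/\mathcal N_{t+R}^{WHW^\dagger}$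 (the latter formed with the range $w+2R$) on both annuli. They carry the twist pairing in $|\psi\rangle$ to that in $W|\psi\rangle$, and the two matrices $\tilde S$ agree up to permutations of rows and columns. -/

import Mathlib

namespace TopOrder

open Matrix Metric
open scoped Kronecker

set_option linter.unusedSectionVars false

/-- The Euclidean plane, in which the sites of the system are located. -/
abbrev Plane := EuclideanSpace ℝ (Fin 2)

section Qudits

variable {Λ : Type*} [Fintype Λ] [DecidableEq Λ] {d : Λ → ℕ}

/-- Computational basis labels of the system with a qudit of dimension `d x` at each site `x`. -/
abbrev Config (d : Λ → ℕ) := ∀ x, Fin (d x)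

/-- Operators on the Hilbert space `⨂ x, ℂ ^ (d x)`. -/
abbrev Op (d : Λ → ℕ) := Matrix (Config d) (Config d) ℂ

/-- Basis labels of the qudits at the sites in `S`. -/
abbrev ConfigOn (d : Λ → ℕ) (S : Set Λ) := ∀ x : {x // x ∈ S}, Fin (d x)

/-- Basis labels of the qudits at the sites outside `S`. -/
abbrev ConfigOff (d : Λ → ℕ) (S : Set Λ) := ∀ x : {x // ¬ x ∈ S}, Fin (d x)

open Classical in
/-- The identification of the Hilbert space with the tensor product of those of `S` and `Sᶜ`,
on basis labels. -/
noncomputable def split (d : Λ → ℕ) (S : Set Λ) : Config d ≃ ConfigOn d S × ConfigOff d S :=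
  Equiv.piEquivPiSubtypeProd (fun x => x ∈ S) (fun x => Fin (d x))

open Classical in
/-- `O` is supported on `S`: it acts by the identity on the complement of `S`, i.e.
`O = A ⊗ 1` for the decomposition of the system into `S` and `Sᶜ`. -/
def SupportedOn (S : Set Λ) (O : Op d) : Prop :=
  ∃ A : Matrix (ConfigOn d S) (ConfigOn d S) ℂ,
    O = (A ⊗ₖ (1 : Matrix (ConfigOff d S) (ConfigOff d S) ℂ)).submatrix (split d S) (split d S)

open Classical in
/-- The reduced density matrix `tr_{Sᶜ} |ψ⟩⟨ψ|`. -/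
noncomputable def reducedDensity (S : Set Λ) (ψ : Config d → ℂ) :
    Matrix (ConfigOn d S) (ConfigOn d S) ℂ :=
  Matrix.of fun σ τ => ∑ η : ConfigOff d S,
    ψ ((split d S).symm (σ, η)) * star (ψ ((split d S).symm (τ, η)))

open Classical in
/-- The twist product `P ∞ Q` for the bipartition `(M, Mᶜ)`: if `P = ∑ j, P_M j ⊗ P_M' j` and
`Q = ∑ k, Q_M k ⊗ Q_M' k`, then `P ∞ Q = ∑ j k, (P_M j * Q_M k) ⊗ (Q_M' k * P_M' j)`.
The matrix elements below are those of this expression (see `twist_kronecker`); here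
`M.piecewise σ κ` is the label that agrees with `σ` on `M` and with `κ` off `M`. -/
noncomputable def twist (M : Set Λ) (P Q : Op d) : Op d :=
  Matrix.of fun σ τ => ∑ κ : Config d,
    P (M.piecewise σ κ) (M.piecewise κ τ) * Q (M.piecewise κ σ) (M.piecewise τ κ)

/-- The twist pairing `⟨ψ| P ∞ Q |ψ⟩`. -/
noncomputable def twistPairing (M : Set Λ) (ψ : Config d → ℂ) (P Q : Op d) : ℂ :=
  star ψ ⬝ᵥ (twist M P Q *ᵥ ψ)

end Qudits

section Support

variable {Λ : Type*} [Fintype Λ] [DecidableEq Λ] {d : Λ → ℕ}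

theorem SupportedOn.mul {S : Set Λ} {O O' : Op d} (h : SupportedOn S O) (h' : SupportedOn S O') :
    SupportedOn S (O * O') := by
  classical
  obtain ⟨A, rfl⟩ := h
  obtain ⟨B, rfl⟩ := h'
  refine ⟨A * B, ?_⟩
  rw [Matrix.submatrix_mul_equiv, ← Matrix.mul_kronecker_mul, one_mul]

theorem SupportedOn.add {S : Set Λ} {O O' : Op d} (h : SupportedOn S O) (h' : SupportedOn S O') :
    SupportedOn S (O + O') := by
  obtain ⟨A, rfl⟩ := h
  obtain ⟨B, rfl⟩ := h'
  exact ⟨A + B, by rw [Matrix.add_kronecker]; rfl⟩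

theorem SupportedOn.smul {S : Set Λ} {O : Op d} (z : ℂ) (h : SupportedOn S O) :
    SupportedOn S (z • O) := by
  obtain ⟨A, rfl⟩ := h
  exact ⟨z • A, by rw [Matrix.smul_kronecker]; rfl⟩

theorem SupportedOn.one {S : Set Λ} : SupportedOn S (1 : Op d) := by
  classical
  exact ⟨1, by rw [Matrix.one_kronecker_one, Matrix.submatrix_one_equiv]⟩

theorem SupportedOn.star {S : Set Λ} {O : Op d} (h : SupportedOn S O) :
    SupportedOn S (star O) := by
  classical
  obtain ⟨A, rfl⟩ := h
  refine ⟨Aᴴ, ?_⟩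
  rw [Matrix.star_eq_conjTranspose, Matrix.conjTranspose_submatrix, Matrix.conjTranspose_kronecker,
    Matrix.conjTranspose_one]

theorem SupportedOn.mono {S T : Set Λ} (hST : S ⊆ T) {O : Op d} (h : SupportedOn S O) :
    SupportedOn T O := by
  classical
  obtain ⟨A, rfl⟩ := h
  refine ⟨Matrix.of fun σ τ => if ∀ x (hx : x ∈ T), x ∉ S → σ ⟨x, hx⟩ = τ ⟨x, hx⟩ then
    A (fun x => σ ⟨x, hST x.2⟩) (fun x => τ ⟨x, hST x.2⟩) else 0, ?_⟩
  ext σ τ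
  have h1 : ∀ U : Set Λ, (split d U σ).2 = (split d U τ).2 ↔ ∀ x, x ∉ U → σ x = τ x := by
    intro U
    rw [funext_iff]
    exact ⟨fun h x hx => h ⟨x, hx⟩, fun h x => h x.1 x.2⟩
  simp only [Matrix.submatrix_apply, Matrix.kroneckerMap_apply, Matrix.one_apply, h1,
    Matrix.of_apply]
  by_cases hS : ∀ x, x ∉ S → σ x = τ x
  · have hT : ∀ x, x ∉ T → σ x = τ x := fun x hx => hS x (fun h => hx (hST h))
    have hTS : ∀ x (hx : x ∈ T), x ∉ S →
        (split d T σ).1 ⟨x, hx⟩ = (split d T τ).1 ⟨x, hx⟩ := fun x _ hx => hS x hx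
    rw [if_pos hS, if_pos hT, if_pos hTS]
    rfl
  · rw [if_neg hS, mul_zero]
    by_cases hT : ∀ x, x ∉ T → σ x = τ x
    · have hTS : ¬ ∀ x (hx : x ∈ T), x ∉ S →
          (split d T σ).1 ⟨x, hx⟩ = (split d T τ).1 ⟨x, hx⟩ := by
        intro h
        refine hS fun x hx => ?_
        by_cases hxT : x ∈ T
        · exact h x hxT hx
        · exact hT x hxT
      rw [if_neg hTS, zero_mul]
    · rw [if_neg hT, mul_zero]

open Classical in
/-- The defining formula of the twist product, on tensor products. -/
theorem twist_kronecker (M : Set Λ) (P Q : Matrix (ConfigOn d M) (ConfigOn d M) ℂ)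
    (P' Q' : Matrix (ConfigOff d M) (ConfigOff d M) ℂ) :
    twist M ((P ⊗ₖ P').submatrix (split d M) (split d M))
      ((Q ⊗ₖ Q').submatrix (split d M) (split d M)) =
    ((P * Q) ⊗ₖ (Q' * P')).submatrix (split d M) (split d M) := by
  ext σ τ
  have h1 : ∀ σ κ : Config d, split d M (M.piecewise σ κ) =
      ((split d M σ).1, (split d M κ).2) := by
    intro σ κ
    refine Prod.ext (funext fun x => ?_) (funext fun x => ?_)
    · exact Set.piecewise_eq_of_mem M _ _ x.2
    · exact Set.piecewise_eq_of_notMem M _ _ x.2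
  simp only [twist, Matrix.of_apply, Matrix.submatrix_apply, h1, Matrix.kroneckerMap_apply,
    Matrix.mul_apply]
  rw [Finset.sum_mul_sum, ← Finset.sum_product', Finset.univ_product_univ]
  refine Fintype.sum_equiv (split d M) _ _ fun κ => ?_
  ring

end Support

section Hamiltonians

variable {Λ : Type*} [Fintype Λ] [DecidableEq Λ] {d : Λ → ℕ}

/-- A commuting projector Hamiltonian `H = - ∑ j, h j`, given by its terms. -/
structure Hamiltonian (d : Λ → ℕ) where
  /-- the number of terms -/
  size : ℕ
  /-- the terms `h j` -/
  term : Fin size → Op d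
  proj : ∀ j, IsStarProjection (term j)
  comm : ∀ i j, Commute (term i) (term j)

/-- Every term is supported on a disk of diameter `w`. -/
def HasInteractionRange (pos : Λ → Plane) (H : Hamiltonian d) (w : ℝ) : Prop :=
  ∀ j, ∃ c : Plane, SupportedOn (pos ⁻¹' closedBall c (w / 2)) (H.term j)

/-- `ψ` is a frustration-free ground state: `h j ψ = ψ` for all `j`. -/
def IsGroundState (H : Hamiltonian d) (ψ : Config d → ℂ) : Prop :=
  ∀ j, H.term j *ᵥ ψ = ψ

/-- Local topological order on the plane of radius `ρ` (the closed disk of radius `ρ` about the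
origin): for every disk `D` in it, every normalized state that is fixed by all terms acting
nontrivially on `D` has the same reduced density matrix on `D` as `ψ`. -/
def LocalTopologicalOrder (pos : Λ → Plane) (H : Hamiltonian d) (ρ : ℝ) (ψ : Config d → ℂ) :
    Prop :=
  ∀ (c : Plane) (s : ℝ), 0 < s → closedBall c s ⊆ closedBall 0 ρ →
    ∀ φ : Config d → ℂ, star φ ⬝ᵥ φ = 1 →
      (∀ j, ¬ SupportedOn (pos ⁻¹' (closedBall c s)ᶜ) (H.term j) → H.term j *ᵥ φ = φ) →
      reducedDensity (pos ⁻¹' closedBall c s) φ = reducedDensity (pos ⁻¹' closedBall c s) ψ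

/-- The annulus of radius `r` and thickness `t` about `c`. -/
def annulus (c : Plane) (r t : ℝ) : Set Plane := {p | r - t ≤ dist p c ∧ dist p c ≤ r + t}

theorem annulus_mono (c : Plane) (r : ℝ) {t t' : ℝ} (h : t ≤ t') :
    annulus c r t ⊆ annulus c r t' :=
  fun _ hp => ⟨by linarith [hp.1], by linarith [hp.2]⟩

/-- The algebra `𝒜_t` of all operators on the annulus of thickness `t` that commute with every
term of `H`. -/
def annulusAlgebra (pos : Λ → Plane) (H : Hamiltonian d) (c : Plane) (r t : ℝ) :
    StarSubalgebra ℂ (Op d) where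
  carrier := {O | SupportedOn (pos ⁻¹' annulus c r t) O ∧ ∀ j, Commute O (H.term j)}
  mul_mem' ha hb := ⟨ha.1.mul hb.1, fun j => (ha.2 j).mul_left (hb.2 j)⟩
  add_mem' ha hb := ⟨ha.1.add hb.1, fun j => (ha.2 j).add_left (hb.2 j)⟩
  algebraMap_mem' z := ⟨by
    rw [Algebra.algebraMap_eq_smul_one]
    exact SupportedOn.one.smul z, fun j => Algebra.commutes z _⟩
  star_mem' ha := ⟨ha.1.star, fun j => by
    have h := (ha.2 j).star_star
    rwa [(H.proj j).isSelfAdjoint.star_eq] at h⟩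

/-- The finite sums `O_1 + ⋯ + O_n` of operators such that each `O_i` is annihilated from both
sides by a term of `H` (of interaction range `w`) on the annulus of thickness `t + w`. -/
def nullSpace (pos : Λ → Plane) (H : Hamiltonian d) (c : Plane) (r w t : ℝ) :
    Submodule ℂ (Op d) :=
  Submodule.span ℂ {X | ∃ j, SupportedOn (pos ⁻¹' annulus c r (t + w)) (H.term j) ∧
    H.term j * X = 0 ∧ X * H.term j = 0}

theorem nullSpace_mul_left {pos : Λ → Plane} {H : Hamiltonian d} {c : Plane} {r w t : ℝ}
    {A : Op d} (hA : ∀ j, Commute A (H.term j)) {X : Op d} (hX : X ∈ nullSpace pos H c r w t) :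
    A * X ∈ nullSpace pos H c r w t := by
  refine Submodule.span_induction (p := fun X _ => A * X ∈ nullSpace pos H c r w t)
    ?_ ?_ ?_ ?_ hX
  · rintro X ⟨j, hj, h1, h2⟩
    refine Submodule.subset_span ⟨j, hj, ?_, ?_⟩
    · rw [← mul_assoc, ← (hA j).eq, mul_assoc, h1, mul_zero]
    · rw [mul_assoc, h2, mul_zero]
  · simp
  · intro X Y _ _ h1 h2
    rw [mul_add]
    exact add_mem h1 h2
  · intro z X _ h1
    rw [mul_smul_comm]
    exact Submodule.smul_mem _ _ h1

theorem nullSpace_star {pos : Λ → Plane} {H : Hamiltonian d} {c : Plane} {r w t : ℝ}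
    {X : Op d} (hX : X ∈ nullSpace pos H c r w t) : star X ∈ nullSpace pos H c r w t := by
  refine Submodule.span_induction (p := fun X _ => star X ∈ nullSpace pos H c r w t)
    ?_ ?_ ?_ ?_ hX
  · rintro X ⟨j, hj, h1, h2⟩
    refine Submodule.subset_span ⟨j, hj, ?_, ?_⟩
    · have h := congrArg star h2
      rwa [star_mul, star_zero, (H.proj j).isSelfAdjoint.star_eq] at h
    · have h := congrArg star h1
      rwa [star_mul, star_zero, (H.proj j).isSelfAdjoint.star_eq] at h
  · simp
  · intro X Y _ _ h1 h2
    rw [star_add]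
    exact add_mem h1 h2
  · intro z X _ h1
    rw [star_smul]
    exact Submodule.smul_mem _ _ h1

theorem nullSpace_mono (pos : Λ → Plane) (H : Hamiltonian d) (c : Plane) (r w : ℝ) {t t' : ℝ}
    (h : t ≤ t') : nullSpace pos H c r w t ≤ nullSpace pos H c r w t' := by
  refine Submodule.span_mono ?_
  rintro X ⟨j, hj, hX⟩
  exact ⟨j, hj.mono (Set.preimage_mono (annulus_mono c r (by linarith))), hX⟩

/-- The ideal `𝒩_t` of `H`-null operators in `𝒜_t`. -/
def nullIdeal (pos : Λ → Plane) (H : Hamiltonian d) (c : Plane) (r w t : ℝ) :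
    Ideal (annulusAlgebra pos H c r t) where
  carrier := {O | (O : Op d) ∈ nullSpace pos H c r w t}
  add_mem' ha hb := (nullSpace pos H c r w t).add_mem ha hb
  zero_mem' := (nullSpace pos H c r w t).zero_mem
  smul_mem' A _ hX := nullSpace_mul_left A.2.2 hX

theorem mem_nullIdeal {pos : Λ → Plane} {H : Hamiltonian d} {c : Plane} {r w t : ℝ}
    {O : annulusAlgebra pos H c r t} :
    O ∈ nullIdeal pos H c r w t ↔ (O : Op d) ∈ nullSpace pos H c r w t := Iff.rfl

theorem star_mem_nullIdeal {pos : Λ → Plane} {H : Hamiltonian d} {c : Plane} {r w t : ℝ}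
    {O : annulusAlgebra pos H c r t} (hO : O ∈ nullIdeal pos H c r w t) :
    star O ∈ nullIdeal pos H c r w t :=
  nullSpace_star (mem_nullIdeal.1 hO)

instance (pos : Λ → Plane) (H : Hamiltonian d) (c : Plane) (r w t : ℝ) :
    (nullIdeal pos H c r w t).IsTwoSided where
  mul_mem_of_left {X} A hX := by
    have h := star_mem_nullIdeal ((nullIdeal pos H c r w t).mul_mem_left (star A)
      (star_mem_nullIdeal hX))
    rwa [star_mul, star_star, star_star] at h

/-- The logical algebra `𝒜_t / 𝒩_t` on the annulus of radius `r` and thickness `t` about `c`. -/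
abbrev LogicalAlgebra (pos : Λ → Plane) (H : Hamiltonian d) (c : Plane) (r w t : ℝ) :=
  annulusAlgebra pos H c r t ⧸ nullIdeal pos H c r w t

/-- The class of an operator of `𝒜_t` in the logical algebra. -/
abbrev toLogical (pos : Λ → Plane) (H : Hamiltonian d) (c : Plane) (r w t : ℝ) :
    annulusAlgebra pos H c r t →+* LogicalAlgebra pos H c r w t :=
  Ideal.Quotient.mk (nullIdeal pos H c r w t)

/-- Some representative of a class. -/
noncomputable def representative {pos : Λ → Plane} {H : Hamiltonian d} {c : Plane} {r w t : ℝ} :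
    LogicalAlgebra pos H c r w t → annulusAlgebra pos H c r t :=
  Function.surjInv (f := toLogical pos H c r w t) Ideal.Quotient.mk_surjective

/-- The involution of the logical algebra induced by that of `𝒜_t`. -/
instance (pos : Λ → Plane) (H : Hamiltonian d) (c : Plane) (r w t : ℝ) :
    StarRing (LogicalAlgebra pos H c r w t) where
  star := Quotient.map' star fun a b hab => by
    rw [Submodule.quotientRel_def] at hab ⊢
    have h := star_mem_nullIdeal hab
    have e : star (a - b) = star a - star b := star_sub a b
    exact e ▸ h
  star_involutive := by
    rintro ⟨a⟩
    exact congrArg (toLogical pos H c r w t) (star_star a)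
  star_mul := by
    rintro ⟨a⟩ ⟨b⟩
    exact congrArg (toLogical pos H c r w t) (star_mul a b)
  star_add := by
    rintro ⟨a⟩ ⟨b⟩
    exact congrArg (toLogical pos H c r w t) (star_add a b)

/-- The inclusion `𝒜_t ⊆ 𝒜_t'` for `t ≤ t'`. -/
def annulusInclusion (pos : Λ → Plane) (H : Hamiltonian d) (c : Plane) (r : ℝ)
    {t t' : ℝ} (h : t ≤ t') : annulusAlgebra pos H c r t →+* annulusAlgebra pos H c r t' where
  toFun O := ⟨O.1, O.2.1.mono (Set.preimage_mono (annulus_mono c r h)), O.2.2⟩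
  map_one' := rfl
  map_mul' _ _ := rfl
  map_zero' := rfl
  map_add' _ _ := rfl

theorem nullIdeal_le_comap (pos : Λ → Plane) (H : Hamiltonian d) (c : Plane) (r w : ℝ)
    {t t' : ℝ} (h : t ≤ t') :
    nullIdeal pos H c r w t ≤
      (nullIdeal pos H c r w t').comap (annulusInclusion pos H c r h) := by
  intro O hO
  rw [Ideal.mem_comap, mem_nullIdeal]
  exact nullSpace_mono pos H c r w h (mem_nullIdeal.1 hO)

/-- The map `𝒜_t / 𝒩_t → 𝒜_t' / 𝒩_t'` induced by the inclusion `𝒜_t ⊆ 𝒜_t'`. -/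
noncomputable def inclusionMap (pos : Λ → Plane) (H : Hamiltonian d) (c : Plane) (r w : ℝ)
    {t t' : ℝ} (h : t ≤ t') :
    LogicalAlgebra pos H c r w t →+* LogicalAlgebra pos H c r w t' :=
  Ideal.quotientMap _ (annulusInclusion pos H c r h) (nullIdeal_le_comap pos H c r w h)

/-- The stable logical algebra condition on the annulus of radius `r` about `c`. -/
def StableLogicalAlgebra (pos : Λ → Plane) (H : Hamiltonian d) (c : Plane) (r w : ℝ) : Prop :=
  ∀ (t t' : ℝ) (h : t ≤ t'), 0 < t → 10 * w ≤ t → t' ≤ r / 10 →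
    Function.Bijective (inclusionMap pos H c r w h)

/-- `H` is an unfrustrated local commuting projector Hamiltonian of interaction range `w` with
ground state `ψ` that satisfies the local topological order condition on the plane of radius `ρ`
and the stable logical algebra condition for the annuli of radius `r` about `cL` and `cR`. -/
structure Admissible (pos : Λ → Plane) (ρ r : ℝ) (cL cR : Plane) (ψ : Config d → ℂ)
    (H : Hamiltonian d) (w : ℝ) : Prop where
  range_nonneg : 0 ≤ w
  range : HasInteractionRange pos H w
  ground : IsGroundState H ψ
  lto : LocalTopologicalOrder pos H ρ ψ
  stableL : StableLogicalAlgebra pos H cL r w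
  stableR : StableLogicalAlgebra pos H cR r w

end Hamiltonians

section FundamentalProjectors

/-- `p` is a fundamental projector of the finite-dimensional `C^*`-algebra `C`: a projector in the
center such that the algebra `p C` (with unit `p`) is simple. These are the projectors of the
decomposition of `C` into simple algebras. -/
def IsFundamentalProjector {C : Type*} [Ring C] [StarRing C] (p : C) : Prop :=
  ∃ hp : IsStarProjection p, p ∈ Subring.center C ∧ IsSimpleRing hp.isIdempotentElem.Corner

/-- The particle types. -/
abbrev FundamentalProjector (C : Type*) [Ring C] [StarRing C] := {p : C // IsFundamentalProjector p}

end FundamentalProjectors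

section Pairing

variable {Λ : Type*} [Fintype Λ] [DecidableEq Λ] {d : Λ → ℕ}

/-- The sites above the line through the centers `cL` and `cR` of the left and the right annulus
(in the frame in which `cL` lies to the left of `cR`). They include the upper one of the two
regions in which the annuli intersect, but not the lower one. -/
def above (pos : Λ → Plane) (cL cR : Plane) : Set Λ :=
  {x | 0 < (cR 0 - cL 0) * (pos x 1 - cL 1) - (cR 1 - cL 1) * (pos x 0 - cL 0)}

/-- A pair of `*`-isomorphisms between the logical algebras on the left and the right annulus
preserves the twist pairing: corresponding classes have, for all choices of representatives,
the same twist pairing. -/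
def PreservesTwistPairing (pos : Λ → Plane) (r : ℝ) (cL cR : Plane)
    {H₁ H₂ : Hamiltonian d} {w₁ t₁ w₂ t₂ : ℝ} (ψ₁ ψ₂ : Config d → ℂ)
    (ΦL : LogicalAlgebra pos H₁ cL r w₁ t₁ ≃⋆ₐ[ℂ] LogicalAlgebra pos H₂ cL r w₂ t₂)
    (ΦR : LogicalAlgebra pos H₁ cR r w₁ t₁ ≃⋆ₐ[ℂ] LogicalAlgebra pos H₂ cR r w₂ t₂) : Prop :=
  ∀ (P₁ : annulusAlgebra pos H₁ cL r t₁) (P₂ : annulusAlgebra pos H₂ cL r t₂)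
    (Q₁ : annulusAlgebra pos H₁ cR r t₁) (Q₂ : annulusAlgebra pos H₂ cR r t₂),
    ΦL (toLogical pos H₁ cL r w₁ t₁ P₁) = toLogical pos H₂ cL r w₂ t₂ P₂ →
    ΦR (toLogical pos H₁ cR r w₁ t₁ Q₁) = toLogical pos H₂ cR r w₂ t₂ Q₂ →
    twistPairing (above pos cL cR) ψ₁ P₁ Q₁ = twistPairing (above pos cL cR) ψ₂ P₂ Q₂

/-- The matrix `S̃ a b = ⟨ψ| π_a ∞ π_b |ψ⟩`, with rows and columns labeled by the fundamental
projectors of the logical algebras on the left and the right annulus, and computed with some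
representatives of these classes. -/
noncomputable def sTilde (pos : Λ → Plane) (r : ℝ) (cL cR : Plane) (ψ : Config d → ℂ)
    (H : Hamiltonian d) (w t : ℝ) :
    Matrix (FundamentalProjector (LogicalAlgebra pos H cL r w t))
      (FundamentalProjector (LogicalAlgebra pos H cR r w t)) ℂ :=
  Matrix.of fun a b => twistPairing (above pos cL cR) ψ
    (representative a.1 : Op d) (representative b.1 : Op d)

/-- Two matrices agree up to a relabeling of rows and columns. -/
def EqUpToPermutation {I J I' J' : Type*} (S : Matrix I J ℂ) (S' : Matrix I' J' ℂ) : Prop :=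
  ∃ (e : I ≃ I') (f : J ≃ J'), S' = Matrix.reindex e f S

end Pairing

section Circuits

variable {Λ : Type*} [Fintype Λ] [DecidableEq Λ] {d : Λ → ℕ}

/-- A unitary operator that acts on at most two qudits, which are nearest neighbors (at distance
at most one); `S` is the set of the qudits it acts on. -/
def IsGate (pos : Λ → Plane) (S : Set Λ) (U : Op d) : Prop :=
  U ∈ unitary (Op d) ∧ SupportedOn S U ∧ ∃ x y, S ⊆ {x, y} ∧ dist (pos x) (pos y) ≤ 1

/-- A layer of a quantum circuit: a product of gates of nonoverlapping supports. -/
def IsLayer (pos : Λ → Plane) (V : Op d) : Prop :=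
  ∃ (n : ℕ) (S : Fin n → Set Λ) (U : Fin n → Op d), (∀ i, IsGate pos (S i) (U i)) ∧
    (∀ i j, i ≠ j → Disjoint (S i) (S j)) ∧ V = (List.ofFn U).prod

/-- A local quantum circuit: an ordered product of layers. -/
def IsQuantumCircuit (pos : Λ → Plane) (W : Op d) : Prop :=
  ∃ l : List (Op d), (∀ V ∈ l, IsLayer pos V) ∧ W = l.prod

/-- Conjugation by `W` enlarges the radius of the supporting disk by at most `R`. -/
def HasCircuitRange (pos : Λ → Plane) (W : Op d) (R : ℝ) : Prop :=
  0 ≤ R ∧ ∀ (c : Plane) (s : ℝ) (O : Op d), SupportedOn (pos ⁻¹' closedBall c s) O →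
    SupportedOn (pos ⁻¹' closedBall c (s + R)) (W * O * star W)

theorem IsQuantumCircuit.mem_unitary {pos : Λ → Plane} {W : Op d} (h : IsQuantumCircuit pos W) :
    W ∈ unitary (Op d) := by
  obtain ⟨l, hl, rfl⟩ := h
  refine Submonoid.list_prod_mem _ fun V hV => ?_
  obtain ⟨n, S, U, hU, -, rfl⟩ := hl V hV
  refine Submonoid.list_prod_mem _ fun X hX => ?_
  obtain ⟨i, rfl⟩ := (List.mem_ofFn' U X).1 hX
  exact (hU i).1

/-- The evolved Hamiltonian `W H W† = - ∑ j, W h_j W†`. -/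
def Hamiltonian.evolve (H : Hamiltonian d) {W : Op d} (hW : W ∈ unitary (Op d)) :
    Hamiltonian d where
  size := H.size
  term j := W * H.term j * star W
  proj j := by
    have h1 : star W * W = 1 := (Unitary.mem_iff.1 hW).1
    refine ⟨?_, ?_⟩
    · change W * H.term j * star W * (W * H.term j * star W) = W * H.term j * star W
      rw [show W * H.term j * star W * (W * H.term j * star W) =
        W * H.term j * (star W * W) * H.term j * star W by simp only [mul_assoc], h1, mul_one,
        mul_assoc W, (H.proj j).isIdempotentElem.eq]
    · change star (W * H.term j * star W) = W * H.term j * star W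
      rw [star_mul, star_mul, star_star, (H.proj j).isSelfAdjoint.star_eq, mul_assoc]
  comm i j := by
    have h1 : star W * W = 1 := (Unitary.mem_iff.1 hW).1
    have key : ∀ A B : Op d, W * A * star W * (W * B * star W) = W * (A * B) * star W := by
      intro A B
      rw [show W * A * star W * (W * B * star W) = W * A * (star W * W) * B * star W by
        simp only [mul_assoc], h1, mul_one, mul_assoc W A B]
    change W * H.term i * star W * (W * H.term j * star W) =
      W * H.term j * star W * (W * H.term i * star W)
    rw [key, key, (H.comm i j).eq]

end Circuits

end TopOrder

open TopOrder
open scoped Matrix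

/-! Write `Π` for the product of the terms of `H` supported on an annulus (`groundProjector`), the
projector onto the states without excitations there. An operator that commutes with `H` is null
exactly when the `Π` of the annulus of thickness `t + w` annihilates it (`mem_nullSpace_iff`). The
logical algebra thus records how operators act on states without excitations near the annulus, and
this can be compared between Hamiltonians.

Let `ψ' = W ψ`, where conjugation by `W` enlarges supports by at most `R`, and let `H`, `H'` have
the ground states `ψ`, `ψ'`. The main point is that if `O` commutes with `H`, then `W O W†` creates
no excitations of `H'` (`LocallyOrdered.term_mul_conj_mul_groundProjector`). To test a term `h'`,
write `O = ∑ X_i Y_i` with `Y_i` on a small disk and `X_i` off it; `Y_i` still commutes with the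
terms of `H` on that disk. So `Y_i ψ` has no excitations where `W† h' W` acts, and local topological
order of `H` gives `W† h' W Y_i ψ = Y_i ψ`. Local topological order of `H'` extends the resulting
identity from `ψ'` to the whole range of `Π'`. Hence `Π' W O W†` lies in the algebra of `H'` on a
somewhat thicker annulus, and stability returns its class to thickness `t`. The relation `Π' (O' - W
O W†) = 0` is then the graph of the isomorphism; surjectivity comes from the same argument for `W†`.

For the twist pairing, the two annuli do not meet near the line through their centers. A term near
one annulus therefore stays on one side of the line or avoids the other annulus. If it also commutes
with the other factor, it can be pulled out of the twist product and absorbed by `ψ`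
(`twist_mul_left`). So an operator annihilated by `Π` has zero pairing with operators commuting with
`H`. The same geometry makes the pairing invariant under conjugation by `W`.

Part 1 is the case `W = 1`. In 2(b) the evolved Hamiltonian is not known to be stable, so
conjugation itself is used, together with stability of `H` only. -/

namespace TopOrder

open Matrix Metric
open scoped Kronecker

set_option linter.unusedSectionVars false

/-! ### Supports, commutants and tensor decompositions -/

section Tensor

variable {Λ : Type*} [Fintype Λ] [DecidableEq Λ] {d : Λ → ℕ}

/-- Support on `S` in terms of matrix elements. -/
theorem supportedOn_iff {S : Set Λ} {O : Op d} : SupportedOn S O ↔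
    (∀ σ τ, (∃ x, x ∉ S ∧ σ x ≠ τ x) → O σ τ = 0) ∧
    (∀ σ τ σ' τ', (∀ x ∈ S, σ x = σ' x) → (∀ x ∈ S, τ x = τ' x) → (∀ x, x ∉ S → σ x = τ x) →
      (∀ x, x ∉ S → σ' x = τ' x) → O σ τ = O σ' τ') := by
  classical
  have h1 : ∀ σ τ : Config d, (split d S σ).2 = (split d S τ).2 ↔ ∀ x, x ∉ S → σ x = τ x := by
    intro σ τ
    rw [funext_iff]
    exact ⟨fun h x hx => h ⟨x, hx⟩, fun h x => h x.1 x.2⟩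
  constructor
  · rintro ⟨A, rfl⟩
    simp only [Matrix.submatrix_apply, Matrix.kroneckerMap_apply, Matrix.one_apply, h1]
    refine ⟨fun σ τ ⟨x, hx, hne⟩ => ?_, fun σ τ σ' τ' hσ hτ h h' => ?_⟩
    · rw [if_neg fun h => hne (h x hx), mul_zero]
    · rw [if_pos h, if_pos h', show (split d S σ).1 = (split d S σ').1 from
        funext fun x => hσ x x.2, show (split d S τ).1 = (split d S τ').1 from
        funext fun x => hτ x x.2]
  · rintro ⟨h0, h⟩
    -- The default `0` is never reached: the matrix elements to be compared supply a label off `S`.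
    refine ⟨Matrix.of fun a b => if hη : Nonempty (ConfigOff d S) then
      O ((split d S).symm (a, hη.some)) ((split d S).symm (b, hη.some)) else 0, ?_⟩
    ext σ τ
    have hη : Nonempty (ConfigOff d S) := ⟨(split d S σ).2⟩
    simp only [Matrix.submatrix_apply, Matrix.kroneckerMap_apply, Matrix.one_apply, h1,
      Matrix.of_apply, dif_pos hη]
    by_cases hστ : ∀ x, x ∉ S → σ x = τ x
    · rw [if_pos hστ, mul_one]
      refine h _ _ _ _ (fun x hx => ?_) (fun x hx => ?_) hστ (fun x hx => ?_)
      · simp [split, Equiv.piEquivPiSubtypeProd, hx]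
      · simp [split, Equiv.piEquivPiSubtypeProd, hx]
      · simp [split, Equiv.piEquivPiSubtypeProd, hx]
    · rw [if_neg hστ, mul_zero]
      push Not at hστ
      exact h0 _ _ hστ

theorem SupportedOn.univ (O : Op d) : SupportedOn Set.univ O :=
  supportedOn_iff.2 ⟨fun _ _ ⟨_, hx, _⟩ => absurd (Set.mem_univ _) hx,
    fun σ τ σ' τ' hσ hτ _ _ => by
      rw [show σ = σ' from funext fun x => hσ x trivial,
        show τ = τ' from funext fun x => hτ x trivial]⟩

theorem SupportedOn.sub {S : Set Λ} {O O' : Op d} (h : SupportedOn S O)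
    (h' : SupportedOn S O') : SupportedOn S (O - O') := by
  rw [sub_eq_add_neg, ← neg_one_smul ℂ O']
  exact h.add (h'.smul _)

/-- The labels are changed in two moves: off `S` first, by support on `S`, and then off `T`, by
support on `T`. -/
theorem SupportedOn.inter {S T : Set Λ} {O : Op d} (hS : SupportedOn S O)
    (hT : SupportedOn T O) : SupportedOn (S ∩ T) O := by
  classical
  rw [supportedOn_iff] at *
  refine ⟨fun σ τ ⟨x, hx, hne⟩ => ?_, fun σ τ σ' τ' hσ hτ h h' => ?_⟩
  · by_cases hxS : x ∈ S
    · exact hT.1 σ τ ⟨x, fun hxT => hx ⟨hxS, hxT⟩, hne⟩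
    · exact hS.1 σ τ ⟨x, hxS, hne⟩
  · have e1 : O σ τ = O (S.piecewise σ σ') (S.piecewise τ τ') := by
      refine hS.2 _ _ _ _ (fun x hx => ?_) (fun x hx => ?_) (fun x hx => ?_) (fun x hx => ?_)
      · rw [Set.piecewise_eq_of_mem _ _ _ hx]
      · rw [Set.piecewise_eq_of_mem _ _ _ hx]
      · exact h x fun hx' => hx hx'.1
      · rw [Set.piecewise_eq_of_notMem _ _ _ hx, Set.piecewise_eq_of_notMem _ _ _ hx]
        exact h' x fun hx' => hx hx'.1
    rw [e1]
    refine hT.2 _ _ _ _ (fun x hx => ?_) (fun x hx => ?_) (fun x hx => ?_) (fun x hx => ?_)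
    · by_cases hxS : x ∈ S
      · rw [Set.piecewise_eq_of_mem _ _ _ hxS]
        exact hσ x ⟨hxS, hx⟩
      · rw [Set.piecewise_eq_of_notMem _ _ _ hxS]
    · by_cases hxS : x ∈ S
      · rw [Set.piecewise_eq_of_mem _ _ _ hxS]
        exact hτ x ⟨hxS, hx⟩
      · rw [Set.piecewise_eq_of_notMem _ _ _ hxS]
    · by_cases hxS : x ∈ S
      · rw [Set.piecewise_eq_of_mem _ _ _ hxS, Set.piecewise_eq_of_mem _ _ _ hxS]
        exact h x fun hx' => hx hx'.2
      · rw [Set.piecewise_eq_of_notMem _ _ _ hxS, Set.piecewise_eq_of_notMem _ _ _ hxS]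
        exact h' x fun hx' => hx hx'.2
    · exact h' x fun hx' => hx hx'.2

open Classical in
/-- The operator `A ⊗ B`, with `A` acting on `S` and `B` on the complement of `S`. -/
noncomputable def tensor (S : Set Λ) (A : Matrix (ConfigOn d S) (ConfigOn d S) ℂ)
    (B : Matrix (ConfigOff d S) (ConfigOff d S) ℂ) : Op d :=
  (A ⊗ₖ B).submatrix (split d S) (split d S)

open Classical in
theorem tensor_mul (S : Set Λ) (A A' : Matrix (ConfigOn d S) (ConfigOn d S) ℂ)
    (B B' : Matrix (ConfigOff d S) (ConfigOff d S) ℂ) :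
    tensor S A B * tensor S A' B' = tensor S (A * A') (B * B') := by
  rw [tensor, tensor, Matrix.submatrix_mul_equiv, ← Matrix.mul_kronecker_mul, tensor]

open Classical in
theorem supportedOn_tensor_one (S : Set Λ) (A : Matrix (ConfigOn d S) (ConfigOn d S) ℂ) :
    SupportedOn S (tensor S A 1) := ⟨A, rfl⟩

open Classical in
theorem supportedOn_compl_iff {S : Set Λ} {O : Op d} :
    SupportedOn Sᶜ O ↔ ∃ B, O = tensor S 1 B := by
  have h1 : ∀ σ τ : Config d, (split d S σ).1 = (split d S τ).1 ↔ ∀ x ∈ S, σ x = τ x := by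
    intro σ τ
    rw [funext_iff]
    exact ⟨fun h x hx => h ⟨x, hx⟩, fun h x => h x.1 x.2⟩
  constructor
  · intro h
    rw [supportedOn_iff] at h
    refine ⟨Matrix.of fun a b => if hη : Nonempty (ConfigOn d S) then
      O ((split d S).symm (hη.some, a)) ((split d S).symm (hη.some, b)) else 0, ?_⟩
    ext σ τ
    have hη : Nonempty (ConfigOn d S) := ⟨(split d S σ).1⟩
    simp only [tensor, Matrix.submatrix_apply, Matrix.kroneckerMap_apply, Matrix.one_apply, h1,
      Matrix.of_apply, dif_pos hη]
    by_cases hστ : ∀ x ∈ S, σ x = τ x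
    · rw [if_pos hστ, one_mul]
      refine h.2 _ _ _ _ (fun x hx => ?_) (fun x hx => ?_) (fun x hx => hστ x (by simpa using hx))
        (fun x hx => ?_)
      · simp only [Set.mem_compl_iff] at hx
        simp [split, Equiv.piEquivPiSubtypeProd, hx]
      · simp only [Set.mem_compl_iff] at hx
        simp [split, Equiv.piEquivPiSubtypeProd, hx]
      · simp only [Set.mem_compl_iff, not_not] at hx
        simp [split, Equiv.piEquivPiSubtypeProd, hx]
    · rw [if_neg hστ, zero_mul]
      push Not at hστ
      obtain ⟨x, hx, hne⟩ := hστ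
      exact h.1 _ _ ⟨x, by simpa using hx, hne⟩
  · rintro ⟨B, rfl⟩
    rw [supportedOn_iff]
    simp only [tensor, Matrix.submatrix_apply, Matrix.kroneckerMap_apply, Matrix.one_apply, h1,
      Set.mem_compl_iff, not_not]
    refine ⟨fun σ τ ⟨x, hx, hne⟩ => ?_, fun σ τ σ' τ' hσ hτ h h' => ?_⟩
    · rw [if_neg fun h => hne (h x hx), zero_mul]
    · rw [if_pos h, if_pos h', show (split d S σ).2 = (split d S σ').2 from
        funext fun x => hσ x x.2, show (split d S τ).2 = (split d S τ').2 from
        funext fun x => hτ x x.2]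

theorem SupportedOn.commute {S T : Set Λ} {O O' : Op d} (h : SupportedOn S O)
    (h' : SupportedOn T O') (hST : Disjoint S T) : Commute O O' := by
  classical
  obtain ⟨A, rfl⟩ := h
  obtain ⟨B, rfl⟩ := supportedOn_compl_iff.1 (h'.mono hST.subset_compl_left)
  change tensor S A 1 * tensor S 1 B = tensor S 1 B * tensor S A 1
  rw [tensor_mul, tensor_mul, one_mul, mul_one, one_mul, mul_one]

/-- The commutant of the operators on `S` consists of the operators on the complement of `S`. -/
theorem supportedOn_compl_of_commute {S : Set Λ} {O : Op d}
    (h : ∀ Z : Op d, SupportedOn S Z → Commute Z O) : SupportedOn Sᶜ O := by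
  classical
  have key : ∀ (A : Matrix (ConfigOn d S) (ConfigOn d S) ℂ) (p q : ConfigOn d S × ConfigOff d S),
      ∑ a, A p.1 a * O ((split d S).symm (a, p.2)) ((split d S).symm q) =
      ∑ a, O ((split d S).symm p) ((split d S).symm (a, q.2)) * A a q.1 := by
    intro A p q
    have h1 := congrFun (congrFun (h _ (supportedOn_tensor_one S A)).eq ((split d S).symm p))
      ((split d S).symm q)
    simp only [Matrix.mul_apply, tensor, Matrix.submatrix_apply, Matrix.kroneckerMap_apply,
      Equiv.apply_symm_apply] at h1
    rw [← Equiv.sum_comp (split d S).symm, ← Equiv.sum_comp (split d S).symm,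
      Fintype.sum_prod_type, Fintype.sum_prod_type] at h1
    simpa [Matrix.one_apply] using h1
  rw [supportedOn_compl_iff]
  by_cases hη : Nonempty (ConfigOn d S)
  · obtain ⟨a₀⟩ := hη
    refine ⟨Matrix.of fun a b => O ((split d S).symm (a₀, a)) ((split d S).symm (a₀, b)), ?_⟩
    ext σ τ
    obtain ⟨p, rfl⟩ := (split d S).symm.surjective σ
    obtain ⟨q, rfl⟩ := (split d S).symm.surjective τ
    -- Commutation with the matrix unit from `p.1` to `a₀` moves every block of `O` to the block at
    -- `a₀`.
    have h2 := key (Matrix.single a₀ p.1 1) (a₀, p.2) q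
    simp only [tensor, Matrix.submatrix_apply, Equiv.apply_symm_apply, Matrix.kroneckerMap_apply,
      Matrix.of_apply, Matrix.one_apply]
    simp only [Matrix.single_apply, true_and, ite_and, ite_mul, one_mul, zero_mul,
      mul_ite, mul_one, mul_zero, Finset.sum_ite_eq, Finset.mem_univ, if_true] at h2
    rw [ite_mul, one_mul, zero_mul]
    simpa using h2
  · exact ⟨0, by ext σ τ; exact absurd ⟨(split d S σ).1⟩ hη⟩

theorem supportedOn_of_forall_notMem {S : Set Λ} {O : Op d}
    (h : ∀ y, y ∉ S → SupportedOn ({y}ᶜ : Set Λ) O) : SupportedOn S O := by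
  classical
  have key : ∀ F : Finset Λ, (∀ y ∈ F, y ∉ S) → SupportedOn ((F : Set Λ)ᶜ) O := by
    intro F
    induction F using Finset.induction_on with
    | empty => exact fun _ => (SupportedOn.univ O).mono (by simp)
    | insert a F _ ih =>
      intro hF
      have h1 := (h a (hF a (Finset.mem_insert_self _ _))).inter
        (ih fun y hy => hF y (Finset.mem_insert_of_mem hy))
      refine h1.mono fun x hx => ?_
      simpa using hx
  refine (key (Finset.univ.filter fun y => y ∉ S) fun y hy => (Finset.mem_filter.1 hy).2).mono ?_
  intro x hx
  simpa using hx

/-- Support on `S` means commuting with all one-site operators off `S`. -/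
theorem supportedOn_of_commute {S : Set Λ} {O : Op d}
    (h : ∀ y, y ∉ S → ∀ Z : Op d, SupportedOn {y} Z → Commute Z O) : SupportedOn S O :=
  supportedOn_of_forall_notMem fun y hy => supportedOn_compl_of_commute (h y hy)

/-- Every operator is a sum of products of operators on `S` and operators on its complement; the
latter commute with each operator on the complement that commutes with the given operator. -/
theorem exists_eq_sum_mul (S : Set Λ) (O : Op d) :
    ∃ (n : ℕ) (X Y : Fin n → Op d), (∀ i, SupportedOn S (X i)) ∧ (∀ i, SupportedOn Sᶜ (Y i)) ∧
      O = ∑ i, X i * Y i ∧ ∀ Z, SupportedOn Sᶜ Z → Commute Z O → ∀ i, Commute Z (Y i) := by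
  classical
  suffices h : ∃ X Y : ConfigOn d S × ConfigOn d S → Op d, (∀ i, SupportedOn S (X i)) ∧
      (∀ i, SupportedOn Sᶜ (Y i)) ∧ O = ∑ i, X i * Y i ∧
      ∀ Z, SupportedOn Sᶜ Z → Commute Z O → ∀ i, Commute Z (Y i) by
    obtain ⟨X, Y, hX, hY, hO, hZ⟩ := h
    let e := (Fintype.equivFin (ConfigOn d S × ConfigOn d S)).symm
    exact ⟨_, X ∘ e, Y ∘ e, fun i => hX _, fun i => hY _,
      hO.trans (Equiv.sum_comp e fun i => X i * Y i).symm, fun Z h h' i => hZ Z h h' _⟩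
  -- Expansion in the matrix units of `S`. The coefficients are determined by `O`, so what commutes
  -- with `O` off `S` commutes with each of them.
  let block : ConfigOn d S → ConfigOn d S → Matrix (ConfigOff d S) (ConfigOff d S) ℂ :=
    fun a b => Matrix.of fun η η' => O ((split d S).symm (a, η)) ((split d S).symm (b, η'))
  refine ⟨fun i => tensor S (Matrix.single i.1 i.2 1) 1, fun i => tensor S 1 (block i.1 i.2),
    fun i => supportedOn_tensor_one _ _, fun i => supportedOn_compl_iff.2 ⟨_, rfl⟩, ?_, ?_⟩
  · ext σ τ
    obtain ⟨p, rfl⟩ := (split d S).symm.surjective σ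
    obtain ⟨q, rfl⟩ := (split d S).symm.surjective τ
    simp only [tensor_mul, mul_one, one_mul, Matrix.sum_apply]
    rw [Finset.sum_eq_single (p.1, q.1)]
    · simp [tensor, block]
    · rintro ⟨a, b⟩ - hne
      simp only [tensor, Matrix.submatrix_apply, Matrix.kroneckerMap_apply,
        Equiv.apply_symm_apply, Matrix.single_apply]
      rw [if_neg, zero_mul]
      rintro ⟨rfl, rfl⟩
      exact hne rfl
    · simp
  · intro Z hZ hcomm i
    obtain ⟨B, rfl⟩ := supportedOn_compl_iff.1 hZ
    have h1 : B * block i.1 i.2 = block i.1 i.2 * B := by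
      ext η η'
      have h2 := congrFun (congrFun hcomm.eq ((split d S).symm (i.1, η)))
        ((split d S).symm (i.2, η'))
      simp only [Matrix.mul_apply, tensor, Matrix.submatrix_apply, Matrix.kroneckerMap_apply,
        Equiv.apply_symm_apply] at h2
      rw [← Equiv.sum_comp (split d S).symm, ← Equiv.sum_comp (split d S).symm,
        Fintype.sum_prod_type, Fintype.sum_prod_type] at h2
      simp only [Matrix.mul_apply, block, Matrix.of_apply]
      rw [Finset.sum_comm] at h2
      simpa [Matrix.one_apply] using h2
    change tensor S 1 B * tensor S 1 _ = tensor S 1 _ * tensor S 1 B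
    rw [tensor_mul, tensor_mul, h1]

end Tensor

/-! ### The twist product and the twist pairing -/

section Twist

variable {Λ : Type*} [Fintype Λ] [DecidableEq Λ] {d : Λ → ℕ}

/-- Every operator on `S` is a sum of products of operators on `S ∩ M` and on `S ∩ Mᶜ`. -/
theorem SupportedOn.exists_eq_sum_mul {S : Set Λ} {O : Op d} (h : SupportedOn S O) (M : Set Λ) :
    ∃ (n : ℕ) (X Y : Fin n → Op d), (∀ i, SupportedOn (S ∩ M) (X i)) ∧
      (∀ i, SupportedOn (S ∩ Mᶜ) (Y i)) ∧ O = ∑ i, X i * Y i := by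
  obtain ⟨n, X, Y, hX, hY, hO, hZ⟩ := TopOrder.exists_eq_sum_mul (S ∩ M) O
  refine ⟨n, X, Y, hX, fun i => ?_, hO⟩
  -- Operators off `S` commute with `O`, hence with the coefficients `Y i`, which must then live on
  -- `S`.
  have h1 : SupportedOn Sᶜᶜ (Y i) := supportedOn_compl_of_commute fun Z hZS =>
    hZ Z (hZS.mono (Set.compl_subset_compl.2 Set.inter_subset_left))
      (hZS.commute h disjoint_compl_left) i
  refine (h1.inter (hY i)).mono fun x hx => ?_
  simp only [compl_compl, Set.mem_inter_iff, Set.mem_compl_iff, not_and] at hx ⊢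
  exact ⟨hx.1, hx.2 hx.1⟩

theorem twist_add_left (M : Set Λ) (P P' Q : Op d) :
    twist M (P + P') Q = twist M P Q + twist M P' Q := by
  ext σ τ
  simp [twist, add_mul, Finset.sum_add_distrib]

theorem twist_zero_left (M : Set Λ) (Q : Op d) : twist M 0 Q = 0 := by
  ext σ τ
  simp [twist]

/-- This symmetry reduces statements about the right factor to statements about the left one. -/
theorem twist_compl (M : Set Λ) (P Q : Op d) : twist Mᶜ P Q = twist M Q P := by
  classical
  ext σ τ
  simp only [twist, Matrix.of_apply, Set.piecewise_compl]
  exact Finset.sum_congr rfl fun κ _ => mul_comm _ _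

theorem twist_sum_left {ι : Type*} (M : Set Λ) (s : Finset ι) (P : ι → Op d) (Q : Op d) :
    twist M (∑ i ∈ s, P i) Q = ∑ i ∈ s, twist M (P i) Q :=
  map_sum (⟨⟨fun P => twist M P Q, twist_zero_left M Q⟩,
    fun P P' => twist_add_left M P P' Q⟩ : Op d →+ Op d) P s

theorem twist_sum_right {ι : Type*} (M : Set Λ) (s : Finset ι) (P : Op d) (Q : ι → Op d) :
    twist M P (∑ i ∈ s, Q i) = ∑ i ∈ s, twist M P (Q i) := by
  simp only [← twist_compl M, twist_sum_left]

/-- On `M` the factor `X` stands to the left of `Q`, and on the complement `Y` stands to its right.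
Twist products thereby become ordinary products, once the left factor is expanded into such `X * Y`.
-/
theorem twist_mul_eq {M : Set Λ} {X Y : Op d} (hX : SupportedOn M X) (hY : SupportedOn Mᶜ Y)
    (Q : Op d) : twist M (X * Y) Q = X * Q * Y := by
  classical
  obtain ⟨n, C, D, hC, hD, rfl, -⟩ := exists_eq_sum_mul M Q
  rw [twist_sum_right, Finset.mul_sum, Finset.sum_mul]
  refine Finset.sum_congr rfl fun i _ => ?_
  obtain ⟨X, rfl⟩ := hX
  obtain ⟨Y, rfl⟩ := supportedOn_compl_iff.1 hY
  obtain ⟨C', hC'⟩ := hC i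
  obtain ⟨D', hD'⟩ := supportedOn_compl_iff.1 (hD i)
  rw [hC', hD']
  change twist M (tensor M X 1 * tensor M 1 Y) (tensor M C' 1 * tensor M 1 D') =
    tensor M X 1 * (tensor M C' 1 * tensor M 1 D') * tensor M 1 Y
  simp only [tensor_mul, one_mul, mul_one]
  exact twist_kronecker M X C' Y D'

/-- The twist product of `X * Y` with `Q` is `X * Q * Y`, provided that `X` crosses to the
complement of `M` and `Y` crosses to `M` only outside the support of `Q`. -/
theorem twist_mul_eq_of_supportedOn {M S : Set Λ} {X Y Q : Op d} (hQ : SupportedOn S Q)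
    (hX : SupportedOn (M ∪ Sᶜ) X) (hY : SupportedOn (Mᶜ ∪ Sᶜ) Y) :
    twist M (X * Y) Q = X * Q * Y := by
  -- The parts `z` of `X` and `v` of `Y` on the wrong side of the cut avoid the support of `Q`. They
  -- commute with `Q` and with each other, so the product can be reordered to respect the cut.
  obtain ⟨m, x, z, hx, hz, rfl⟩ := hX.exists_eq_sum_mul M
  obtain ⟨n, v, y, hv, hy, rfl⟩ := hY.exists_eq_sum_mul M
  simp only [Finset.sum_mul, Finset.mul_sum, twist_sum_left]
  refine Finset.sum_congr rfl fun j _ => Finset.sum_congr rfl fun i _ => ?_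
  have hx' : SupportedOn M (x i) := (hx i).mono Set.inter_subset_right
  have hy' : SupportedOn Mᶜ (y j) := (hy j).mono Set.inter_subset_right
  have hz' : SupportedOn Mᶜ (z i) := (hz i).mono Set.inter_subset_right
  have hv' : SupportedOn M (v j) := (hv j).mono fun a ha => by
    by_contra h
    exact h (by simpa using ha.2)
  have hzQ : Commute (z i) Q := by
    refine (hz i).commute hQ (Set.disjoint_left.2 fun a ha => ?_)
    rcases ha with ⟨h1 | h1, h2⟩
    exacts [absurd h1 h2, h1]
  have hvQ : Commute (v j) Q := by
    refine (hv j).commute hQ (Set.disjoint_left.2 fun a ha => ?_)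
    rcases ha with ⟨h1 | h1, h2⟩
    exacts [absurd h2 h1, h1]
  have hvz : Commute (v j) (z i) := hv'.commute hz' disjoint_compl_right
  have e1 : x i * z i * (v j * y j) = x i * v j * (z i * y j) := by
    simp only [mul_assoc]
    rw [← mul_assoc (z i), ← hvz.eq, mul_assoc]
  rw [e1, twist_mul_eq (hx'.mul hv') (hz'.mul hy')]
  simp only [mul_assoc]
  rw [← mul_assoc (v j) Q, hvQ.eq, mul_assoc, ← mul_assoc (v j) (z i), hvz.eq, mul_assoc,
    ← mul_assoc Q (z i), ← hzQ.eq, mul_assoc]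

/-- On `M` the factor `h` is outermost already. On the complement the twist leaves it to the right
of `Q`, and `hc` brings it out. If it crosses the cut, it must do so off the support of `Q`. -/
theorem twist_mul_left {M S : Set Λ} {h P Q : Op d} (hQ : SupportedOn S Q) (hc : Commute h Q)
    (hh : SupportedOn M h ∨ SupportedOn Mᶜ h ∨ SupportedOn Sᶜ h) :
    twist M (h * P) Q = h * twist M P Q := by
  obtain ⟨n, x, y, hx, hy, rfl, -⟩ := exists_eq_sum_mul M P
  simp only [Finset.mul_sum, twist_sum_left]
  refine Finset.sum_congr rfl fun i _ => ?_
  rw [twist_mul_eq (hx i) (hy i)]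
  rcases hh with hh | hh | hh
  · rw [← mul_assoc, twist_mul_eq (hh.mul (hx i)) (hy i)]
    simp only [mul_assoc]
  · have hxh : Commute h (x i) := hh.commute (hx i) disjoint_compl_left
    rw [← mul_assoc, hxh.eq, mul_assoc, twist_mul_eq (hx i) (hh.mul (hy i))]
    simp only [mul_assoc]
    rw [← mul_assoc Q h, ← hc.eq, ← mul_assoc h (x i), hxh.eq]
    simp only [mul_assoc]
  · rw [← mul_assoc, twist_mul_eq_of_supportedOn hQ
      ((hh.mono Set.subset_union_right).mul ((hx i).mono Set.subset_union_left))
      ((hy i).mono Set.subset_union_left)]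
    simp only [mul_assoc]

/-- Conjugation may push the two halves of `P` across the cut, but only off the support of the
evolved `Q`; the twist product is then still the product `X * Q * Y`, which conjugation respects. -/
theorem twist_conj {M S T : Set Λ} {W P Q : Op d} (hW : star W * W = 1) (hP : SupportedOn T P)
    (hQ : SupportedOn S (W * Q * star W))
    (hX : ∀ X, SupportedOn (T ∩ M) X → SupportedOn (M ∪ Sᶜ) (W * X * star W))
    (hY : ∀ Y, SupportedOn (T ∩ Mᶜ) Y → SupportedOn (Mᶜ ∪ Sᶜ) (W * Y * star W)) :
    twist M (W * P * star W) (W * Q * star W) = W * twist M P Q * star W := by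
  have key : ∀ A B : Op d, W * A * star W * (W * B * star W) = W * (A * B) * star W := by
    intro A B
    rw [show W * A * star W * (W * B * star W) = W * A * (star W * W) * B * star W by
      simp only [mul_assoc], hW, mul_one, mul_assoc W A B]
  obtain ⟨n, x, y, hx, hy, rfl⟩ := hP.exists_eq_sum_mul M
  simp only [Finset.mul_sum, Finset.sum_mul, twist_sum_left]
  refine Finset.sum_congr rfl fun i _ => ?_
  rw [← key, twist_mul_eq_of_supportedOn hQ (hX _ (hx i)) (hY _ (hy i)), key, key,
    twist_mul_eq ((hx i).mono Set.inter_subset_right) ((hy i).mono Set.inter_subset_right)]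

theorem twistPairing_mul_left {M S : Set Λ} {ψ : Config d → ℂ} {h P Q : Op d}
    (hQ : SupportedOn S Q) (hc : Commute h Q)
    (hh : SupportedOn M h ∨ SupportedOn Mᶜ h ∨ SupportedOn Sᶜ h)
    (hs : star h = h) (hψ : h *ᵥ ψ = ψ) :
    twistPairing M ψ (h * P) Q = twistPairing M ψ P Q := by
  rw [twistPairing, twist_mul_left hQ hc hh, ← Matrix.mulVec_mulVec, Matrix.dotProduct_mulVec,
    ← hs, Matrix.star_eq_conjTranspose, ← Matrix.star_mulVec, hψ, twistPairing]

theorem twistPairing_compl (M : Set Λ) (ψ : Config d → ℂ) (P Q : Op d) :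
    twistPairing Mᶜ ψ P Q = twistPairing M ψ Q P := by
  rw [twistPairing, twist_compl, twistPairing]

theorem twistPairing_sub_left (M : Set Λ) (ψ : Config d → ℂ) (P P' Q : Op d) :
    twistPairing M ψ (P - P') Q = twistPairing M ψ P Q - twistPairing M ψ P' Q := by
  have h := twist_add_left M (P - P') P' Q
  rw [sub_add_cancel] at h
  simp only [twistPairing]
  rw [h, Matrix.add_mulVec, dotProduct_add, add_sub_cancel_right]

theorem twistPairing_zero_left (M : Set Λ) (ψ : Config d → ℂ) (Q : Op d) :
    twistPairing M ψ 0 Q = 0 := by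
  rw [twistPairing, twist_zero_left, Matrix.zero_mulVec, dotProduct_zero]

theorem twistPairing_conj {M S T : Set Λ} {W P Q : Op d} (hW : star W * W = 1)
    (hP : SupportedOn T P) (hQ : SupportedOn S (W * Q * star W))
    (hX : ∀ X, SupportedOn (T ∩ M) X → SupportedOn (M ∪ Sᶜ) (W * X * star W))
    (hY : ∀ Y, SupportedOn (T ∩ Mᶜ) Y → SupportedOn (Mᶜ ∪ Sᶜ) (W * Y * star W))
    (ψ : Config d → ℂ) :
    twistPairing M (W *ᵥ ψ) (W * P * star W) (W * Q * star W) = twistPairing M ψ P Q := by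
  rw [twistPairing, twist_conj hW hP hQ hX hY, Matrix.star_mulVec, ← Matrix.dotProduct_mulVec,
    Matrix.mulVec_mulVec, Matrix.mulVec_mulVec, ← Matrix.star_eq_conjTranspose]
  rw [show star W * (W * twist M P Q * star W) * W = (star W * W) * twist M P Q * (star W * W) by
    simp only [mul_assoc], hW, one_mul, mul_one, twistPairing]

end Twist

/-! ### Local topological order and projectors onto unexcited states -/

section GroundProjector

variable {Λ : Type*} [Fintype Λ] [DecidableEq Λ] {d : Λ → ℕ}

theorem dotProduct_tensor_mulVec (S : Set Λ) (φ : Config d → ℂ)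
    (A : Matrix (ConfigOn d S) (ConfigOn d S) ℂ) [Fintype (ConfigOn d S)]
    [DecidableEq (ConfigOff d S)] :
    star φ ⬝ᵥ ((A ⊗ₖ (1 : Matrix (ConfigOff d S) (ConfigOff d S) ℂ)).submatrix
      (split d S) (split d S) *ᵥ φ) = ∑ a, ∑ b, A a b * reducedDensity S φ b a := by
  classical
  simp only [dotProduct, mulVec, Matrix.submatrix_apply, Matrix.kroneckerMap_apply, Pi.star_apply]
  rw [← Equiv.sum_comp (split d S).symm, Fintype.sum_prod_type]
  have h1 : ∀ (a : ConfigOn d S) (η : ConfigOff d S), ∑ τ : Config d,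
      A a (split d S τ).1 * (1 : Matrix (ConfigOff d S) (ConfigOff d S) ℂ) η (split d S τ).2 * φ τ =
      ∑ b, A a b * φ ((split d S).symm (b, η)) := by
    intro a η
    rw [← Equiv.sum_comp (split d S).symm, Fintype.sum_prod_type]
    simp [Matrix.one_apply]
  simp only [Equiv.apply_symm_apply, h1]
  convert Finset.sum_congr rfl fun a _ => ?_ using 1
  simp only [reducedDensity, Matrix.of_apply, Finset.mul_sum]
  rw [Finset.sum_comm]
  convert Finset.sum_congr rfl fun b _ => ?_ using 1
  convert Finset.sum_congr rfl fun η _ => ?_ using 1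
  ring

theorem dotProduct_mulVec_eq_of_reducedDensity_eq {S : Set Λ} {φ ψ : Config d → ℂ}
    (h : reducedDensity S φ = reducedDensity S ψ) {O : Op d} (hO : SupportedOn S O) :
    star φ ⬝ᵥ (O *ᵥ φ) = star ψ ⬝ᵥ (O *ᵥ ψ) := by
  classical
  obtain ⟨A, rfl⟩ := hO
  rw [dotProduct_tensor_mulVec, dotProduct_tensor_mulVec, h]

open scoped ComplexOrder in
/-- Under local topological order, an operator on a disk that annihilates the ground state
annihilates all states without excitations near the disk. -/
theorem LocalTopologicalOrder.mulVec_eq_zero {pos : Λ → Plane} {H : Hamiltonian d} {ρ : ℝ}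
    {ψ : Config d → ℂ} (hlto : LocalTopologicalOrder pos H ρ ψ) {c : Plane} {s : ℝ} (hs : 0 < s)
    (hD : closedBall c s ⊆ closedBall 0 ρ) {X : Op d}
    (hX : SupportedOn (pos ⁻¹' closedBall c s) X) (hXψ : X *ᵥ ψ = 0) {φ : Config d → ℂ}
    (hφ : ∀ j, ¬ SupportedOn (pos ⁻¹' (closedBall c s)ᶜ) (H.term j) → H.term j *ᵥ φ = φ) :
    X *ᵥ φ = 0 := by
  by_cases h0 : φ = 0
  · rw [h0, Matrix.mulVec_zero]
  have hpos : 0 < star φ ⬝ᵥ φ :=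
    lt_of_le_of_ne (dotProduct_star_self_nonneg φ)
      (Ne.symm fun h => h0 (dotProduct_star_self_eq_zero.1 h))
  obtain ⟨x, hx, hxe⟩ : ∃ x : ℝ, 0 < x ∧ (x : ℂ) = star φ ⬝ᵥ φ :=
    ⟨_, (Complex.pos_iff.1 hpos).1, Complex.ext rfl (Complex.pos_iff.1 hpos).2⟩
  -- Local topological order concerns unit vectors, so `φ` is normalized.
  set k : ℂ := (((Real.sqrt x)⁻¹ : ℝ) : ℂ) with hk
  have hk0 : k ≠ 0 := by
    rw [hk]
    exact_mod_cast inv_ne_zero (Real.sqrt_ne_zero'.2 hx)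
  have hkk : star k * k * x = 1 := by
    rw [hk, Complex.star_def, Complex.conj_ofReal]
    norm_cast
    rw [← mul_inv, Real.mul_self_sqrt hx.le, inv_mul_cancel₀ hx.ne']
  have hnorm : star (k • φ) ⬝ᵥ (k • φ) = 1 := by
    rw [star_smul, smul_dotProduct, dotProduct_smul, ← hxe, smul_eq_mul, smul_eq_mul,
      ← mul_assoc, hkk]
  have h1 := hlto c s hs hD (k • φ) hnorm fun j hj => by rw [Matrix.mulVec_smul, hφ j hj]
  -- Equality of the expectation values of `X† X` compares the norms of `X φ` and `X ψ`.
  have h2 := dotProduct_mulVec_eq_of_reducedDensity_eq h1 (hX.star.mul hX)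
  rw [← Matrix.mulVec_mulVec, ← Matrix.mulVec_mulVec, hXψ, Matrix.mulVec_zero, dotProduct_zero,
    Matrix.dotProduct_mulVec, Matrix.star_eq_conjTranspose, ← Matrix.star_mulVec] at h2
  have h3 := dotProduct_star_self_eq_zero.1 h2
  rw [Matrix.mulVec_smul] at h3
  exact (smul_eq_zero.1 h3).resolve_left hk0

theorem HasInteractionRange.mono {pos : Λ → Plane} {H : Hamiltonian d} {w w' : ℝ}
    (h : HasInteractionRange pos H w) (hw : w ≤ w') : HasInteractionRange pos H w' := fun j => by
  obtain ⟨c, hc⟩ := h j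
  exact ⟨c, hc.mono (Set.preimage_mono (closedBall_subset_closedBall (by linarith)))⟩

/-- A term acts trivially on a given region, or else its disk meets the region. -/
theorem HasInteractionRange.supportedOn_compl_or {pos : Λ → Plane} {H : Hamiltonian d} {w : ℝ}
    (h : HasInteractionRange pos H w) (T : Set Plane) (j : Fin H.size) :
    SupportedOn (pos ⁻¹' Tᶜ) (H.term j) ∨ ∃ p : Plane, ∃ z ∈ T, dist z p ≤ w / 2 ∧
      SupportedOn (pos ⁻¹' closedBall p (w / 2)) (H.term j) := by
  obtain ⟨p, hp⟩ := h j
  by_cases hz : ∃ z ∈ T, dist z p ≤ w / 2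
  · obtain ⟨z, hz, hzp⟩ := hz
    exact Or.inr ⟨p, z, hz, hzp, hp⟩
  · push Not at hz
    refine Or.inl (hp.mono fun x hx hxT => ?_)
    exact absurd (mem_closedBall.1 hx) (not_le.2 (hz _ hxT))

theorem HasInteractionRange.supportedOn_closedBall {pos : Λ → Plane} {H : Hamiltonian d}
    {w : ℝ}
    (h : HasInteractionRange pos H w) {c : Plane} {s : ℝ} {j : Fin H.size}
    (hj : ¬ SupportedOn (pos ⁻¹' (closedBall c s)ᶜ) (H.term j)) :
    SupportedOn (pos ⁻¹' closedBall c (s + w)) (H.term j) := by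
  obtain ⟨p, z, hz, hzp, hp⟩ := (h.supportedOn_compl_or (closedBall c s) j).resolve_left hj
  refine hp.mono (Set.preimage_mono fun q hq => ?_)
  rw [mem_closedBall] at *
  linarith [dist_triangle q p c, dist_triangle p z c, dist_comm p z]

/-- The product of the terms of `H` supported on the region `S`, the projector onto the states
without excitations in `S`. -/
noncomputable def groundProjector (pos : Λ → Plane) (H : Hamiltonian d) (S : Set Plane) : Op d :=
  open Classical in
  ((List.finRange H.size).map fun j =>
    if SupportedOn (pos ⁻¹' S) (H.term j) then H.term j else 1).prod

variable {pos : Λ → Plane} {H : Hamiltonian d} {S T : Set Plane}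

/-- Most properties of the projector are deduced from this principle, which hides the list of
factors. -/
theorem groundProjector_induction (C : Op d → Prop) (h1 : C 1)
    (hmul : ∀ j, SupportedOn (pos ⁻¹' S) (H.term j) → ∀ O, C O → C (H.term j * O)) :
    C (groundProjector pos H S) := by
  classical
  rw [groundProjector]
  induction List.finRange H.size with
  | nil => simpa using h1
  | cons j l ih =>
    rw [List.map_cons, List.prod_cons]
    split_ifs with hj
    · exact hmul j hj _ ih
    · rwa [one_mul]

theorem commute_groundProjector {Z : Op d}
    (hZ : ∀ j, SupportedOn (pos ⁻¹' S) (H.term j) → Commute Z (H.term j)) :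
    Commute Z (groundProjector pos H S) :=
  groundProjector_induction (fun O => Commute Z O) (Commute.one_right _)
    fun j hj _ hO => (hZ j hj).mul_right hO

theorem supportedOn_groundProjector : SupportedOn (pos ⁻¹' S) (groundProjector pos H S) :=
  groundProjector_induction (fun O => SupportedOn (pos ⁻¹' S) O) SupportedOn.one
    fun _ hj _ hO => hj.mul hO

theorem term_commute_groundProjector (j : Fin H.size) :
    Commute (H.term j) (groundProjector pos H S) :=
  commute_groundProjector fun i _ => H.comm j i

theorem star_groundProjector : star (groundProjector pos H S) = groundProjector pos H S := by
  refine (groundProjector_induction (pos := pos) (H := H) (S := S)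
    (fun O => star O = O ∧ ∀ j, Commute (H.term j) O)
    ⟨star_one _, fun _ => Commute.one_right _⟩ fun j _ O hO => ⟨?_, fun i => ?_⟩).1
  · rw [star_mul, hO.1, (H.proj j).isSelfAdjoint.star_eq, (hO.2 j).eq]
  · exact (H.comm i j).mul_right (hO.2 i)

theorem term_mul_groundProjector {j : Fin H.size} (hj : SupportedOn (pos ⁻¹' S) (H.term j)) :
    H.term j * groundProjector pos H S = groundProjector pos H S := by
  classical
  -- The induction principle forgets which terms occur, so the list is kept here and the given term
  -- is commuted to its own copy.
  rw [groundProjector]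
  generalize hl : List.finRange H.size = l
  have hmem : j ∈ l := hl ▸ List.mem_finRange j
  clear hl
  induction l with
  | nil => simp at hmem
  | cons i l ih =>
    rw [List.map_cons, List.prod_cons, ← mul_assoc]
    rcases List.mem_cons.1 hmem with rfl | h
    · rw [if_pos hj, (H.proj j).isIdempotentElem.eq]
    · have hc : Commute (H.term j) (if SupportedOn (pos ⁻¹' S) (H.term i) then H.term i else 1) := by
        split_ifs
        exacts [H.comm j i, Commute.one_right _]
      rw [hc.eq, mul_assoc, ih h]

theorem groundProjector_mul_term {j : Fin H.size} (hj : SupportedOn (pos ⁻¹' S) (H.term j)) :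
    groundProjector pos H S * H.term j = groundProjector pos H S := by
  rw [← (term_commute_groundProjector j).eq, term_mul_groundProjector hj]

theorem groundProjector_mul_eq {X : Op d}
    (hX : ∀ j, SupportedOn (pos ⁻¹' S) (H.term j) → H.term j * X = X) :
    groundProjector pos H S * X = X :=
  groundProjector_induction (fun O => O * X = X) (one_mul _)
    fun j hj O hO => by rw [mul_assoc, hO, hX j hj]

theorem groundProjector_mul_of_subset (h : S ⊆ T) :
    groundProjector pos H S * groundProjector pos H T = groundProjector pos H T :=
  groundProjector_mul_eq fun _ hj => term_mul_groundProjector (hj.mono (Set.preimage_mono h))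

theorem mul_groundProjector_of_subset (h : S ⊆ T) :
    groundProjector pos H T * groundProjector pos H S = groundProjector pos H T := by
  have h1 := congrArg star (groundProjector_mul_of_subset (pos := pos) (H := H) h)
  rwa [star_mul, star_groundProjector, star_groundProjector] at h1

theorem groundProjector_mul_eq_zero_of_subset (h : S ⊆ T) {X : Op d}
    (hX : groundProjector pos H S * X = 0) : groundProjector pos H T * X = 0 := by
  rw [← mul_groundProjector_of_subset h, mul_assoc, hX, mul_zero]

theorem groundProjector_mul_eq_zero_of_mem_nullSpace {c : Plane} {r w t : ℝ} {X : Op d}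
    (hX : X ∈ nullSpace pos H c r w t) :
    groundProjector pos H (annulus c r (t + w)) * X = 0 := by
  refine Submodule.span_induction
    (p := fun X _ => groundProjector pos H (annulus c r (t + w)) * X = 0) ?_ ?_ ?_ ?_ hX
  · rintro X ⟨j, hj, h1, -⟩
    rw [← groundProjector_mul_term hj, mul_assoc, h1, mul_zero]
  · exact mul_zero _
  · intro X Y _ _ hX hY
    rw [mul_add, hX, hY, add_zero]
  · intro z X _ hX
    rw [mul_smul_comm, hX, smul_zero]

/-- An operator that commutes with `H` is `H`-null if and only if it annihilates the states without
excitations near the annulus. -/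
theorem mem_nullSpace_iff {c : Plane} {r w t : ℝ} {X : Op d} (hX : ∀ j, Commute X (H.term j)) :
    X ∈ nullSpace pos H c r w t ↔ groundProjector pos H (annulus c r (t + w)) * X = 0 := by
  refine ⟨groundProjector_mul_eq_zero_of_mem_nullSpace, fun h => ?_⟩
  -- Telescoping of `X - Π X`: each new factor `h j` contributes `(1 - h j) O X`, which `h j`
  -- annihilates from both sides because everything commutes with it.
  have key := groundProjector_induction (pos := pos) (H := H) (S := annulus c r (t + w))
    (fun O => X - O * X ∈ nullSpace pos H c r w t ∧ ∀ j, Commute (H.term j) O)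
    ⟨by simp, fun _ => Commute.one_right _⟩ fun j hj O hO =>
      ⟨?_, fun i => (H.comm i j).mul_right (hO.2 i)⟩
  · simpa [h] using key.1
  · rw [show X - H.term j * O * X = (X - O * X) + (1 - H.term j) * (O * X) by noncomm_ring]
    refine add_mem hO.1 (Submodule.subset_span ⟨j, hj, ?_, ?_⟩)
    · rw [← mul_assoc, mul_sub, mul_one, (H.proj j).isIdempotentElem.eq, sub_self, zero_mul]
    · rw [mul_assoc, mul_assoc, (hX j).eq, ← mul_assoc O, ← (hO.2 j).eq, mul_assoc,
        ← mul_assoc, sub_mul, one_mul, (H.proj j).isIdempotentElem.eq, sub_self, zero_mul]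

/-- An operator on a disk that annihilates the ground state annihilates the projector onto the
states without excitations near the disk. -/
theorem LocalTopologicalOrder.mul_groundProjector_eq_zero {ρ w : ℝ} {ψ : Config d → ℂ}
    (hlto : LocalTopologicalOrder pos H ρ ψ) (hw : HasInteractionRange pos H w)
    {c : Plane} {s : ℝ} (hs : 0 < s) (hD : closedBall c s ⊆ closedBall 0 ρ)
    (hS : closedBall c (s + w) ⊆ S) {X : Op d}
    (hX : SupportedOn (pos ⁻¹' closedBall c s) X) (hXψ : X *ᵥ ψ = 0) :
    X * groundProjector pos H S = 0 := by
  -- Each column of the projector is a state without excitations near the disk.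
  refine Matrix.ext_col fun τ => ?_
  have h1 : (X * groundProjector pos H S).col τ = X *ᵥ (groundProjector pos H S).col τ := rfl
  rw [h1]
  refine hlto.mulVec_eq_zero hs hD hX hXψ fun j hj => ?_
  have hjS : SupportedOn (pos ⁻¹' S) (H.term j) :=
    (hw.supportedOn_closedBall hj).mono (Set.preimage_mono hS)
  change (H.term j * groundProjector pos H S).col τ = _
  rw [term_mul_groundProjector hjS]

end GroundProjector

/-! ### Spreading of supports under conjugation -/

section Spreading

variable {Λ : Type*} [Fintype Λ] [DecidableEq Λ] {d : Λ → ℕ} {pos : Λ → Plane}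

/-- The closed `R`-neighborhood of a region. -/
def neighborhood (R : ℝ) (S : Set Plane) : Set Plane := {p | ∃ q ∈ S, dist p q ≤ R}

theorem neighborhood_closedBall_subset (R : ℝ) (c : Plane) (s : ℝ) :
    neighborhood R (closedBall c s) ⊆ closedBall c (s + R) := by
  rintro p ⟨q, hq, hpq⟩
  rw [mem_closedBall] at *
  linarith [dist_triangle p q c]

theorem neighborhood_annulus_subset (R : ℝ) (c : Plane) (r t : ℝ) :
    neighborhood R (annulus c r t) ⊆ annulus c r (t + R) := by
  rintro p ⟨q, hq, hpq⟩
  exact ⟨by linarith [hq.1, dist_triangle_left q c p],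
    by linarith [hq.2, dist_triangle p q c]⟩

theorem closedBall_subset_annulus {c p z : Plane} {r t t' a s : ℝ} (hz : z ∈ annulus c r t)
    (hzp : dist z p ≤ a) (h : t + a + s ≤ t') : closedBall p s ⊆ annulus c r t' := by
  intro q hq
  rw [mem_closedBall] at hq
  exact ⟨by linarith [hz.1, dist_triangle z p c, dist_triangle_left p c q],
    by linarith [hz.2, dist_triangle q p c, dist_triangle_left p c z]⟩

theorem annulus_subset_closedBall {c : Plane} {r t : ℝ} (h : t ≤ r / 10) :
    annulus c r t ⊆ closedBall c (r + r / 10) :=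
  fun _ hq => mem_closedBall.2 (by linarith [hq.2])

theorem conj_mul_conj {W : Op d} (hW : W ∈ unitary (Op d)) (A B : Op d) :
    W * A * star W * (W * B * star W) = W * (A * B) * star W := by
  rw [show W * A * star W * (W * B * star W) = W * A * (star W * W) * B * star W by
    simp only [mul_assoc], (Unitary.mem_iff.1 hW).1, mul_one, mul_assoc W A B]

theorem star_conj_conj {W : Op d} (hW : W ∈ unitary (Op d)) (A : Op d) :
    star W * (W * A * star W) * W = A := by
  rw [show star W * (W * A * star W) * W = (star W * W) * A * (star W * W) by
    simp only [mul_assoc], (Unitary.mem_iff.1 hW).1, mul_one, one_mul]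

theorem conj_star_conj {W : Op d} (hW : W ∈ unitary (Op d)) (A : Op d) :
    W * (star W * A * W) * star W = A := by
  rw [show W * (star W * A * W) * star W = (W * star W) * A * (W * star W) by
    simp only [mul_assoc], (Unitary.mem_iff.1 hW).2, mul_one, one_mul]

theorem conj_injective {W : Op d} (hW : W ∈ unitary (Op d)) {A B : Op d}
    (h : W * A * star W = W * B * star W) : A = B := by
  rw [← star_conj_conj hW A, h, star_conj_conj hW]

theorem Commute.conj {W A B : Op d} (hW : W ∈ unitary (Op d)) (h : Commute A B) :
    Commute (W * A * star W) (W * B * star W) := by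
  change _ * _ = _ * _
  rw [conj_mul_conj hW, conj_mul_conj hW, h.eq]

/-- Conjugation by `W` enlarges supports by at most `R`. -/
def SpreadsBy (pos : Λ → Plane) (W : Op d) (R : ℝ) : Prop :=
  ∀ (S : Set Plane) (O : Op d), SupportedOn (pos ⁻¹' S) O →
    SupportedOn (pos ⁻¹' neighborhood R S) (W * O * star W)

/-- By duality, `W† O W` acts trivially at `y` as soon as `O` commutes with all `W Z W†`, `Z` at
`y`. Hence control of single sites under `W` controls arbitrary regions under `W†`. -/
theorem spreadsBy_star_of_singleton {W : Op d} (hW : W ∈ unitary (Op d)) {R : ℝ}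
    (h : ∀ (y : Λ) (Z : Op d), SupportedOn {y} Z →
      SupportedOn (pos ⁻¹' closedBall (pos y) R) (W * Z * star W)) :
    SpreadsBy pos (star W) R := by
  intro S O hO
  refine supportedOn_of_commute fun y hy Z hZ => ?_
  have h1 : Commute (W * Z * star W) O := (h y Z hZ).commute hO <|
    Set.disjoint_left.2 fun x hx hxS => hy ⟨pos x, hxS, by rw [dist_comm]; exact hx⟩
  have h2 := Commute.conj (Unitary.star_mem hW) h1
  rw [star_star, star_conj_conj hW] at h2
  rwa [star_star]

theorem SpreadsBy.star {W : Op d} (hW : W ∈ unitary (Op d)) {R : ℝ} (h : SpreadsBy pos W R) :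
    SpreadsBy pos (star W) R := by
  refine spreadsBy_star_of_singleton hW fun y Z hZ => ?_
  refine (h {pos y} Z (hZ.mono fun x hx => ?_)).mono (Set.preimage_mono ?_)
  · rw [Set.mem_singleton_iff.1 hx]
    rfl
  · rintro p ⟨q, hq, hpq⟩
    rw [Set.mem_singleton_iff.1 hq] at hpq
    exact hpq

/-- The range of a circuit is defined by disks, but annuli are needed. Passing to `W†` and back uses
only disks of radius `0` and yields all regions. -/
theorem HasCircuitRange.spreadsBy {W : Op d} (hW : W ∈ unitary (Op d)) {R : ℝ}
    (h : HasCircuitRange pos W R) : SpreadsBy pos W R := by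
  have h1 : SpreadsBy pos (Star.star W) R := by
    refine spreadsBy_star_of_singleton hW fun y Z hZ => ?_
    have h2 := h.2 (pos y) 0 Z (hZ.mono fun x hx => by
      rw [Set.mem_singleton_iff.1 hx]
      exact mem_closedBall_self le_rfl)
    rwa [zero_add] at h2
  have h3 := h1.star (Unitary.star_mem hW)
  rwa [star_star] at h3

theorem SpreadsBy.closedBall {W : Op d} {R : ℝ} (h : SpreadsBy pos W R) {c : Plane} {s : ℝ}
    {O : Op d} (hO : SupportedOn (pos ⁻¹' closedBall c s) O) :
    SupportedOn (pos ⁻¹' Metric.closedBall c (s + R)) (W * O * Star.star W) :=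
  (h _ _ hO).mono (Set.preimage_mono (neighborhood_closedBall_subset R c s))

theorem SpreadsBy.annulus {W : Op d} {R : ℝ} (h : SpreadsBy pos W R) {c : Plane} {r t : ℝ}
    {O : Op d} (hO : SupportedOn (pos ⁻¹' annulus c r t) O) :
    SupportedOn (pos ⁻¹' TopOrder.annulus c r (t + R)) (W * O * Star.star W) :=
  (h _ _ hO).mono (Set.preimage_mono (neighborhood_annulus_subset R c r t))

end Spreading

/-! ### Comparison of the excitations of two Hamiltonians -/

section Comparison

variable {Λ : Type*} [Fintype Λ] [DecidableEq Λ] {d : Λ → ℕ} {pos : Λ → Plane}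

/-- Such an operator is a scalar. This disposes of a term supported on an annulus that its disk does
not meet. -/
theorem eq_zero_of_supportedOn_empty {X : Op d} (hX : SupportedOn ∅ X) {ψ : Config d → ℂ}
    (hψ : ψ ≠ 0) (h : X *ᵥ ψ = 0) : X = 0 := by
  obtain ⟨σ₀, hσ₀⟩ := Function.ne_iff.1 hψ
  rw [supportedOn_iff] at hX
  have h1 : ∀ σ τ, σ ≠ τ → X σ τ = 0 := fun σ τ hne => by
    obtain ⟨x, hx⟩ := Function.ne_iff.1 hne
    exact hX.1 σ τ ⟨x, Set.notMem_empty x, hx⟩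
  have h2 : X σ₀ σ₀ = 0 := by
    have h3 := congrFun h σ₀
    rw [Matrix.mulVec, dotProduct, Finset.sum_eq_single σ₀
      (fun τ _ hne => by rw [h1 _ _ hne.symm, zero_mul]) (by simp)] at h3
    exact (mul_eq_zero.1 h3).resolve_right hσ₀
  ext σ τ
  by_cases hστ : σ = τ
  · subst hστ
    rw [hX.2 σ σ σ₀ σ₀ (by simp) (by simp) (by simp) (by simp), h2, Matrix.zero_apply]
  · exact h1 σ τ hστ

/-- `ψ` is a frustration-free ground state, with local topological order, of the Hamiltonian `H`
of interaction range `δ`. -/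
structure LocallyOrdered (pos : Λ → Plane) (ρ δ : ℝ) (ψ : Config d → ℂ) (H : Hamiltonian d) :
    Prop where
  range : HasInteractionRange pos H δ
  ground : IsGroundState H ψ
  lto : LocalTopologicalOrder pos H ρ ψ
  ne_zero : ψ ≠ 0

variable {ρ δ R : ℝ} {ψ ψ' : Config d → ℂ} {H H' : Hamiltonian d} {W : Op d} {c : Plane} {r x y : ℝ}

/-- An operator that commutes with `H`, evolved by `W`, creates no local excitations of `H'`. -/
theorem LocallyOrdered.term_mul_conj_mul_groundProjector (hH : LocallyOrdered pos ρ δ ψ H)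
    (hH' : LocallyOrdered pos ρ δ ψ' H') (hδ : 0 < δ) (hW : W ∈ unitary (Op d))
    (hWψ : W *ᵥ ψ = ψ') (hR : 0 ≤ R) (hWR : SpreadsBy pos W R)
    (hD : closedBall c (r + r / 10) ⊆ closedBall 0 ρ) (hxy : x + 3 * R + 3 * δ ≤ y)
    (hy : y ≤ r / 10) {O : Op d} (hO : SupportedOn (pos ⁻¹' annulus c r x) O)
    (hc : ∀ j, Commute O (H.term j)) (j : Fin H'.size) (hj : SupportedOn (pos ⁻¹' annulus c r y)
      (H'.term j)) :
    H'.term j * (W * O * star W * groundProjector pos H' (annulus c r y)) =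
      W * O * star W * groundProjector pos H' (annulus c r y) := by
  rcases hH'.range.supportedOn_compl_or (annulus c r (x + R)) j with h | ⟨p, z, hz, hzp, hp⟩
  · have h1 : Commute (H'.term j) (W * O * star W) := h.commute (hWR.annulus hO) <|
      Set.disjoint_left.2 fun _ h h' => h h'
    rw [← mul_assoc, h1.eq, mul_assoc, term_mul_groundProjector hj]
  have hball : ∀ s, s + δ / 2 + R + x ≤ r / 10 → closedBall p s ⊆ closedBall 0 ρ := fun s hs =>
    ((closedBall_subset_annulus hz hzp (by linarith)).trans (annulus_subset_closedBall hs)).trans hD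
  -- The radius `δ / 2 + R` holds `W† h' W`; the additional `δ` makes room for all terms of `H`
  -- acting on that disk.
  obtain ⟨n, X, Y, hX, hY, rfl, hYc⟩ :=
    exists_eq_sum_mul (pos ⁻¹' closedBall p (δ / 2 + R + δ))ᶜ O
  rw [compl_compl] at hY hYc
  have hg : SupportedOn (pos ⁻¹' closedBall p (δ / 2 + R)) (star W * H'.term j * W - 1) := by
    have h1 := (hWR.star hW).closedBall hp
    rw [star_star] at h1
    exact h1.sub SupportedOn.one
  have hψψ' : star W *ᵥ ψ' = ψ := by
    rw [← hWψ, Matrix.mulVec_mulVec, (Unitary.mem_iff.1 hW).1, Matrix.one_mulVec]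
  have hgψ : (star W * H'.term j * W - 1) *ᵥ ψ = 0 := by
    rw [Matrix.sub_mulVec, Matrix.one_mulVec, ← Matrix.mulVec_mulVec, ← Matrix.mulVec_mulVec, hWψ,
      hH'.ground j, hψψ', sub_self]
  -- `Y i` commutes with the terms of `H` near the disk, so `Y i ψ` has no excitations there and
  -- local topological order of `H` applies.
  have hgY : ∀ i, (star W * H'.term j * W - 1) *ᵥ (Y i *ᵥ ψ) = 0 := by
    intro i
    refine hH.lto.mulVec_eq_zero (by linarith) (hball _ (by linarith)) hg hgψ fun k hk => ?_
    have h1 := hYc (H.term k) (hH.range.supportedOn_closedBall hk) (hc k).symm i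
    rw [Matrix.mulVec_mulVec, h1.eq, ← Matrix.mulVec_mulVec, hH.ground k]
  have hWW' := (Unitary.mem_iff.1 hW).2
  -- The conjugated operator lives on radius `3 δ / 2 + 2 R` and annihilates `ψ'`. Its disk,
  -- enlarged by `δ`, is centered within `δ / 2` of the annulus of thickness `x + R`, whence the
  -- bound `x + 3 R + 3 δ ≤ y`.
  have hZ : ∀ i, W * ((star W * H'.term j * W - 1) * Y i) * star W *
      groundProjector pos H' (annulus c r y) = 0 := by
    intro i
    refine hH'.lto.mul_groundProjector_eq_zero hH'.range (c := p) (s := δ / 2 + R + δ + R)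
      (by linarith) (hball _ (by linarith)) (closedBall_subset_annulus hz hzp (by linarith))
      (hWR.closedBall (SupportedOn.mul (hg.mono (Set.preimage_mono
        (closedBall_subset_closedBall (by linarith)))) (hY i))) ?_
    rw [← Matrix.mulVec_mulVec, hψψ', ← Matrix.mulVec_mulVec, ← Matrix.mulVec_mulVec, hgY,
      Matrix.mulVec_zero]
  rw [← sub_eq_zero]
  -- `X i` acts off the disk, so it commutes with `W† h' W - 1` and can be moved to the front.
  have hsum : H'.term j * (W * (∑ i, X i * Y i) * star W * groundProjector pos H' (annulus c r y)) -
      W * (∑ i, X i * Y i) * star W * groundProjector pos H' (annulus c r y) =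
      ∑ i, W * X i * star W * (W * ((star W * H'.term j * W - 1) * Y i) * star W *
      groundProjector pos H' (annulus c r y)) := by
    simp only [Finset.mul_sum, Finset.sum_mul]
    rw [← Finset.sum_sub_distrib]
    refine Finset.sum_congr rfl fun i _ => ?_
    have hcX : Commute (star W * H'.term j * W - 1) (X i) :=
      hg.commute (hX i) <| Set.disjoint_left.2 fun a ha ha' => ha' <|
        closedBall_subset_closedBall (by linarith) ha
    rw [← mul_assoc (W * X i * star W), conj_mul_conj hW, ← mul_assoc (X i), ← hcX.eq,
      mul_assoc (star W * H'.term j * W - 1), sub_mul, one_mul, mul_sub, sub_mul, sub_mul]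
    congr 1
    rw [show W * (star W * H'.term j * W * (X i * Y i)) * star W =
      (W * star W) * H'.term j * (W * (X i * Y i) * star W) by simp only [mul_assoc], hWW', one_mul]
    simp only [mul_assoc]
  rw [hsum]
  exact Finset.sum_eq_zero fun i _ => by rw [hZ i, mul_zero]

/-- The range of the projector is invariant under `W O W†` and, the algebra being closed under
adjoints, under `W O† W†`; both together give commutation. -/
theorem LocallyOrdered.commute_groundProjector_conj (hH : LocallyOrdered pos ρ δ ψ H)
    (hH' : LocallyOrdered pos ρ δ ψ' H') (hδ : 0 < δ) (hW : W ∈ unitary (Op d))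
    (hWψ : W *ᵥ ψ = ψ') (hR : 0 ≤ R) (hWR : SpreadsBy pos W R)
    (hD : closedBall c (r + r / 10) ⊆ closedBall 0 ρ) (hxy : x + 3 * R + 3 * δ ≤ y)
    (hy : y ≤ r / 10) (O : annulusAlgebra pos H c r x) :
    Commute (groundProjector pos H' (annulus c r y)) (W * (O : Op d) * star W) := by
  have h1 : ∀ O : annulusAlgebra pos H c r x, groundProjector pos H' (annulus c r y) *
      (W * (O : Op d) * star W * groundProjector pos H' (annulus c r y)) =
      W * (O : Op d) * star W * groundProjector pos H' (annulus c r y) := fun O =>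
    groundProjector_mul_eq fun j hj => hH.term_mul_conj_mul_groundProjector hH' hδ hW hWψ hR hWR hD
      hxy hy O.2.1 O.2.2 j hj
  have h2 := congrArg star (h1 (star O))
  simp only [star_mul, star_star, star_groundProjector, StarMemClass.coe_star, ← mul_assoc] at h2
  have h3 := h1 O
  simp only [← mul_assoc] at h3
  change _ * _ = _ * _
  simp only [← mul_assoc]
  rw [← h2, h3]

/-- The states without excitations of `H'` in a large annulus have no excitations of the evolved
Hamiltonian `W H W†` in a smaller one. -/
theorem LocallyOrdered.conj_groundProjector_mul (hH : LocallyOrdered pos ρ δ ψ H)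
    (hH' : LocallyOrdered pos ρ δ ψ' H') (hδ : 0 < δ) (hW : W ∈ unitary (Op d))
    (hWψ : W *ᵥ ψ = ψ') (hR : 0 ≤ R) (hWR : SpreadsBy pos W R)
    (hD : closedBall c (r + r / 10) ⊆ closedBall 0 ρ) (hxy : x + R + 2 * δ ≤ y)
    (hy : y ≤ r / 10) :
    W * groundProjector pos H (annulus c r x) * star W * groundProjector pos H' (annulus c r y) =
      groundProjector pos H' (annulus c r y) := by
  have hψψ' : star W *ᵥ ψ' = ψ := by
    rw [← hWψ, Matrix.mulVec_mulVec, (Unitary.mem_iff.1 hW).1, Matrix.one_mulVec]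
  refine groundProjector_induction (pos := pos) (H := H) (S := annulus c r x)
    (fun O => W * O * star W * groundProjector pos H' (annulus c r y) =
      groundProjector pos H' (annulus c r y)) ?_ fun j hj O hO => ?_
  · rw [mul_one, (Unitary.mem_iff.1 hW).2, one_mul]
  rw [← conj_mul_conj hW, mul_assoc, hO]
  rcases hH.range.supportedOn_compl_or (annulus c r x) j with h | ⟨p, z, hz, hzp, hp⟩
  · have h1 : H.term j - 1 = 0 := eq_zero_of_supportedOn_empty
      (((hj.inter h).mono fun a ha => ha.2 ha.1).sub SupportedOn.one) hH.ne_zero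
      (by rw [Matrix.sub_mulVec, Matrix.one_mulVec, hH.ground j, sub_self])
    rw [sub_eq_zero.1 h1, mul_one, (Unitary.mem_iff.1 hW).2, one_mul]
  · rw [← sub_eq_zero]
    nth_rewrite 2 [← one_mul (groundProjector pos H' (annulus c r y))]
    rw [← sub_mul]
    -- `W h W† - 1` lives on this disk and annihilates `ψ'`. The disk and its `δ`-neighborhood fit
    -- because `x + δ / 2 + (δ / 2 + R) + δ ≤ y`.
    refine hH'.lto.mul_groundProjector_eq_zero hH'.range (c := p) (s := δ / 2 + R)
      (by linarith) (((closedBall_subset_annulus hz hzp (by linarith)).trans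
        (annulus_subset_closedBall hy)).trans hD)
      (closedBall_subset_annulus hz hzp (by linarith)) ((hWR.closedBall hp).sub SupportedOn.one) ?_
    rw [Matrix.sub_mulVec, Matrix.one_mulVec, ← Matrix.mulVec_mulVec, ← Matrix.mulVec_mulVec, hψψ',
      hH.ground j, hWψ, sub_self]

theorem LocallyOrdered.groundProjector_mul_conj (hH : LocallyOrdered pos ρ δ ψ H)
    (hH' : LocallyOrdered pos ρ δ ψ' H') (hδ : 0 < δ) (hW : W ∈ unitary (Op d))
    (hWψ : W *ᵥ ψ = ψ') (hR : 0 ≤ R) (hWR : SpreadsBy pos W R)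
    (hD : closedBall c (r + r / 10) ⊆ closedBall 0 ρ) (hxy : x + R + 2 * δ ≤ y)
    (hy : y ≤ r / 10) :
    groundProjector pos H' (annulus c r y) * (W * groundProjector pos H (annulus c r x) * star W) =
      groundProjector pos H' (annulus c r y) := by
  have h := congrArg star (hH.conj_groundProjector_mul hH' hδ hW hWψ hR hWR hD hxy hy)
  rwa [star_mul, star_mul, star_mul, star_star, star_groundProjector, star_groundProjector,
    ← mul_assoc W] at h

end Comparison

/-! ### Transport of fundamental projectors -/

section FundamentalProjectorMap

theorem IsFundamentalProjector.map {C C' : Type*} [Ring C] [StarRing C] [Algebra ℂ C] [Ring C']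
    [StarRing C'] [Algebra ℂ C'] (Φ : C ≃⋆ₐ[ℂ] C') {p : C} (h : IsFundamentalProjector p) :
    IsFundamentalProjector (Φ p) := by
  obtain ⟨hp, hc, hs⟩ := h
  have hp' : IsStarProjection (Φ p) := hp.map Φ
  have hfwd : ∀ x : hp.isIdempotentElem.Corner, Φ x.1 ∈ Subsemigroup.corner (Φ p) := by
    rintro ⟨x, y, rfl⟩
    exact ⟨Φ y, by simp⟩
  have hbwd : ∀ x : hp'.isIdempotentElem.Corner, Φ.symm x.1 ∈ Subsemigroup.corner p := by
    rintro ⟨x, y, rfl⟩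
    exact ⟨Φ.symm y, by simp⟩
  refine ⟨hp', Subring.mem_center_iff.2 fun g => ?_, ?_⟩
  · obtain ⟨g, rfl⟩ : ∃ g', Φ g' = g := ⟨Φ.symm g, Φ.apply_symm_apply g⟩
    rw [← map_mul, ← map_mul, Subring.mem_center_iff.1 hc g]
  · exact IsSimpleRing.of_ringEquiv
      { toFun := fun x => ⟨Φ x.1, hfwd x⟩
        invFun := fun x => ⟨Φ.symm x.1, hbwd x⟩
        left_inv := fun x => Subtype.ext (Φ.symm_apply_apply x.1)
        right_inv := fun x => Subtype.ext (Φ.apply_symm_apply x.1)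
        map_mul' := fun x y => Subtype.ext (map_mul Φ x.1 y.1)
        map_add' := fun x y => Subtype.ext (map_add Φ x.1 y.1) } hs

/-- Isomorphic `C^*`-algebras have corresponding fundamental projectors. -/
def fundamentalProjectorEquiv {C C' : Type*} [Ring C] [StarRing C] [Algebra ℂ C] [Ring C']
    [StarRing C'] [Algebra ℂ C'] (Φ : C ≃⋆ₐ[ℂ] C') :
    FundamentalProjector C ≃ FundamentalProjector C' :=
  Φ.toEquiv.subtypeEquiv fun p => ⟨fun h => h.map Φ, fun h => by
    have h1 := h.map Φ.symm
    rwa [show Φ.symm (Φ.toEquiv p) = p from Φ.symm_apply_apply p] at h1⟩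

end FundamentalProjectorMap

/-! ### Isomorphisms of logical algebras from relations -/

section LogicalAlgebra

variable {Λ : Type*} [Fintype Λ] [DecidableEq Λ] {d : Λ → ℕ} {pos : Λ → Plane}

theorem toLogical_representative {H : Hamiltonian d} {c : Plane} {r w t : ℝ}
    (a : LogicalAlgebra pos H c r w t) : toLogical pos H c r w t (representative a) = a :=
  Function.surjInv_eq _ a

theorem toLogical_eq_iff {H : Hamiltonian d} {c : Plane} {r w t : ℝ}
    {a b : annulusAlgebra pos H c r t} :
    toLogical pos H c r w t a = toLogical pos H c r w t b ↔
      (a : Op d) - (b : Op d) ∈ nullSpace pos H c r w t :=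
  Ideal.Quotient.mk_eq_mk_iff_sub_mem a b

/-- Preservation of the pairing holds for all representatives, in particular for those chosen in
`sTilde`. -/
theorem PreservesTwistPairing.eqUpToPermutation {r : ℝ} {cL cR : Plane} {H₁ H₂ : Hamiltonian d}
    {w₁ t₁ w₂ t₂ : ℝ} {ψ₁ ψ₂ : Config d → ℂ}
    {ΦL : LogicalAlgebra pos H₁ cL r w₁ t₁ ≃⋆ₐ[ℂ] LogicalAlgebra pos H₂ cL r w₂ t₂}
    {ΦR : LogicalAlgebra pos H₁ cR r w₁ t₁ ≃⋆ₐ[ℂ] LogicalAlgebra pos H₂ cR r w₂ t₂}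
    (h : PreservesTwistPairing pos r cL cR ψ₁ ψ₂ ΦL ΦR) :
    EqUpToPermutation (sTilde pos r cL cR ψ₁ H₁ w₁ t₁) (sTilde pos r cL cR ψ₂ H₂ w₂ t₂) := by
  refine ⟨fundamentalProjectorEquiv ΦL, fundamentalProjectorEquiv ΦR, ?_⟩
  ext a b
  rw [Matrix.reindex_apply, Matrix.submatrix_apply]
  refine (h _ _ _ _ ?_ ?_).symm
  · rw [toLogical_representative, toLogical_representative]
    exact ΦL.apply_symm_apply a.1
  · rw [toLogical_representative, toLogical_representative]
    exact ΦR.apply_symm_apply b.1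

/-- A `*`-subalgebra of `𝒜₁ × 𝒜₂` that projects onto both factors and matches the null ideals is the
graph of an isomorphism of logical algebras, up to null operators. -/
theorem exists_logicalAlgebra_starAlgEquiv {H₁ H₂ : Hamiltonian d} {c : Plane} {r w₁ t₁ w₂ t₂ : ℝ}
    (rel : annulusAlgebra pos H₁ c r t₁ → annulusAlgebra pos H₂ c r t₂ → Prop)
    (hadd : ∀ {a b a' b'}, rel a b → rel a' b' → rel (a + a') (b + b'))
    (hmul : ∀ {a b a' b'}, rel a b → rel a' b' → rel (a * a') (b * b'))
    (hsmul : ∀ (z : ℂ) {a b}, rel a b → rel (z • a) (z • b))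
    (hstar : ∀ {a b}, rel a b → rel (star a) (star b))
    (hleft : ∀ a, ∃ b, rel a b) (hright : ∀ b, ∃ a, rel a b)
    (hnull : ∀ {a b}, rel a b →
      ((a : Op d) ∈ nullSpace pos H₁ c r w₁ t₁ ↔ (b : Op d) ∈ nullSpace pos H₂ c r w₂ t₂)) :
    ∃ Φ : LogicalAlgebra pos H₁ c r w₁ t₁ ≃⋆ₐ[ℂ] LogicalAlgebra pos H₂ c r w₂ t₂,
      ∀ a b, rel a b → Φ (toLogical pos H₁ c r w₁ t₁ a) = toLogical pos H₂ c r w₂ t₂ b := by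
  choose f hf using hleft
  choose g hg using hright
  -- The relation passes to differences, so matching null operators gives well-definedness and
  -- injectivity at once.
  have key : ∀ {a b a' b'}, rel a b → rel a' b' →
      (toLogical pos H₁ c r w₁ t₁ a = toLogical pos H₁ c r w₁ t₁ a' ↔
        toLogical pos H₂ c r w₂ t₂ b = toLogical pos H₂ c r w₂ t₂ b') := by
    intro a b a' b' h h'
    have h1 := hnull (hadd h (hsmul (-1) h'))
    rw [toLogical_eq_iff, toLogical_eq_iff]
    simpa [sub_eq_add_neg] using h1
  let F : LogicalAlgebra pos H₁ c r w₁ t₁ → LogicalAlgebra pos H₂ c r w₂ t₂ :=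
    fun q => toLogical pos H₂ c r w₂ t₂ (f (representative q))
  let G : LogicalAlgebra pos H₂ c r w₂ t₂ → LogicalAlgebra pos H₁ c r w₁ t₁ :=
    fun q => toLogical pos H₁ c r w₁ t₁ (g (representative q))
  have hF : ∀ a b, rel a b → F (toLogical pos H₁ c r w₁ t₁ a) = toLogical pos H₂ c r w₂ t₂ b :=
    fun a b h => (key (hf _) h).1 (toLogical_representative _)
  have hG : ∀ a b, rel a b → G (toLogical pos H₂ c r w₂ t₂ b) = toLogical pos H₁ c r w₁ t₁ a :=
    fun a b h => (key (hg _) h).2 (toLogical_representative _)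
  refine ⟨{ toFun := F, invFun := G, left_inv := ?_, right_inv := ?_, map_mul' := ?_,
            map_add' := ?_, map_star' := ?_, map_smul' := ?_ }, hF⟩
  · intro q
    obtain ⟨a, rfl⟩ := Ideal.Quotient.mk_surjective q
    rw [hF a _ (hf a), hG a _ (hf a)]
  · intro q
    obtain ⟨b, rfl⟩ := Ideal.Quotient.mk_surjective q
    rw [hG _ b (hg b), hF _ b (hg b)]
  · intro q q'
    obtain ⟨a, rfl⟩ := Ideal.Quotient.mk_surjective q
    obtain ⟨a', rfl⟩ := Ideal.Quotient.mk_surjective q'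
    rw [← map_mul, hF _ _ (hmul (hf a) (hf a')), hF _ _ (hf a), hF _ _ (hf a'), map_mul]
  · intro q q'
    obtain ⟨a, rfl⟩ := Ideal.Quotient.mk_surjective q
    obtain ⟨a', rfl⟩ := Ideal.Quotient.mk_surjective q'
    rw [← map_add, hF _ _ (hadd (hf a) (hf a')), hF _ _ (hf a), hF _ _ (hf a'), map_add]
  · intro q
    obtain ⟨a, rfl⟩ := Ideal.Quotient.mk_surjective q
    exact (hF _ _ (hstar (hf a))).trans (congrArg star (hF _ _ (hf a))).symm
  · intro z q
    obtain ⟨a, rfl⟩ := Ideal.Quotient.mk_surjective q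
    exact (hF _ _ (hsmul z (hf a))).trans (congrArg (z • ·) (hF _ _ (hf a))).symm

end LogicalAlgebra

/-! ### Geometry of the two annuli -/

section Geometry

variable {cL cR : Plane} {r T : ℝ}

/-- The height above the line through `cL` and `cR`, up to the factor `dist cL cR`. -/
def height (cL cR p : Plane) : ℝ :=
  (cR 0 - cL 0) * (p 1 - cL 1) - (cR 1 - cL 1) * (p 0 - cL 0)

theorem dist_sq_eq (p q : Plane) : dist p q ^ 2 = (p 0 - q 0) ^ 2 + (p 1 - q 1) ^ 2 := by
  rw [EuclideanSpace.dist_eq, Real.sq_sqrt (by positivity), Fin.sum_univ_two, Real.dist_eq,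
    Real.dist_eq, sq_abs, sq_abs]

theorem abs_height_sub_le (p q : Plane) :
    |height cL cR p - height cL cR q| ≤ dist cL cR * dist p q := by
  refine abs_le_of_sq_le_sq ?_ (by positivity)
  rw [mul_pow, dist_sq_eq, dist_sq_eq, height, height]
  -- Lagrange's identity: the squares of the cross product and of the scalar product sum to the
  -- product of the squared lengths.
  nlinarith [sq_nonneg ((cR 0 - cL 0) * (p 0 - q 0) + (cR 1 - cL 1) * (p 1 - q 1))]

/-- Near the line through the centers, the two annuli do not meet. -/
theorem false_of_mem_annulus_of_height (hT : 8 * T < r) (hmin : r / 2 ≤ dist cL cR)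
    (hmax : dist cL cR ≤ 3 * r / 2) {z x y : Plane} (hzL : z ∈ annulus cL r T)
    (hzR : z ∈ annulus cR r T) (hx : 0 < height cL cR x) (hy : height cL cR y ≤ 0)
    (hzx : dist z x ≤ T) (hzy : dist z y ≤ T) : False := by
  have hT0 : 0 ≤ T := dist_nonneg.trans hzx
  set D := dist cL cR with hDdef
  have hD : 0 < D := by linarith
  have hD2 : D ^ 2 = (cL 0 - cR 0) ^ 2 + (cL 1 - cR 1) ^ 2 := dist_sq_eq cL cR
  -- `a` and `b` are the coordinates of `z` along and across the line, with origin `cL`; the nearby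
  -- points `x` and `y` on its two sides give `|b| ≤ T`.
  obtain ⟨b, hb⟩ : ∃ b, D * b = height cL cR z := ⟨height cL cR z / D, by field_simp⟩
  obtain ⟨a, ha⟩ : ∃ a, D * a = (cR 0 - cL 0) * (z 0 - cL 0) + (cR 1 - cL 1) * (z 1 - cL 1) :=
    ⟨((cR 0 - cL 0) * (z 0 - cL 0) + (cR 1 - cL 1) * (z 1 - cL 1)) / D, by field_simp⟩
  have hb1 : b ≤ T := by
    have h1 := (abs_le.1 (abs_height_sub_le (cL := cL) (cR := cR) z y)).2
    have h2 : D * dist z y ≤ D * T := by gcongr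
    exact le_of_mul_le_mul_left (by linarith) hD
  have hb2 : -T ≤ b := by
    have h1 := (abs_le.1 (abs_height_sub_le (cL := cL) (cR := cR) z x)).1
    have h2 : D * dist z x ≤ D * T := by gcongr
    exact le_of_mul_le_mul_left (by linarith) hD
  have hL : dist z cL ^ 2 = a ^ 2 + b ^ 2 := by
    have h1 : D ^ 2 * dist z cL ^ 2 = D ^ 2 * (a ^ 2 + b ^ 2) := by
      rw [mul_add, ← mul_pow, ← mul_pow, ← mul_pow, ha, hb, mul_pow, hD2, dist_sq_eq, height]
      ring
    exact mul_left_cancel₀ (by positivity) h1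
  have hR : dist z cR ^ 2 = (a - D) ^ 2 + b ^ 2 := by
    have h1 : dist z cR ^ 2 = dist z cL ^ 2 - 2 * (D * a) + D ^ 2 := by
      rw [ha, hD2, dist_sq_eq, dist_sq_eq]
      ring
    rw [h1, hL]
    ring
  have hbT : |b| ≤ T := abs_le.2 ⟨hb2, hb1⟩
  have bound : ∀ u D' : ℝ, 0 ≤ D' → D' ^ 2 = u ^ 2 + b ^ 2 → |u| ≤ D' ∧ D' ≤ |u| + T := by
    intro u D' h0 h
    constructor
    · exact abs_le_of_sq_le_sq (by nlinarith [sq_nonneg b]) h0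
    · refine (abs_le_of_sq_le_sq' ?_ (by positivity)).2
      nlinarith [abs_nonneg u, abs_nonneg b, sq_abs u, sq_abs b, mul_nonneg (abs_nonneg u) hT0]
  obtain ⟨h1, h2⟩ := bound a _ dist_nonneg hL
  obtain ⟨h3, h4⟩ := bound (a - D) _ dist_nonneg hR
  have h5 := hzL.1
  have h6 := hzL.2
  have h7 := hzR.1
  have h8 := hzR.2
  -- Both `|a|` and `|a - D|` lie between `r - 2 T` and `r + T`. Equal signs give `D ≤ 3 T < r / 2`,
  -- opposite signs `D ≥ 2 r - 4 T > 3 r / 2`.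
  rcases abs_cases a with ⟨e, _⟩ | ⟨e, _⟩ <;> rcases abs_cases (a - D) with ⟨e', _⟩ | ⟨e', _⟩ <;>
    linarith

end Geometry

/-! ### Vanishing and invariance of the twist pairing -/

section TwistInvariance

variable {Λ : Type*} [Fintype Λ] [DecidableEq Λ] {d : Λ → ℕ} {pos : Λ → Plane}
  {cL cR : Plane} {r T : ℝ}

theorem mem_above_iff {x : Λ} : x ∈ above pos cL cR ↔ 0 < height cL cR (pos x) := Iff.rfl

/-- An operator on a small region either does not cross the line through the centers or acts
off one of the annuli. -/
theorem supportedOn_above_or (hT : 8 * T < r) (hmin : r / 2 ≤ dist cL cR)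
    (hmax : dist cL cR ≤ 3 * r / 2) {E B : Set Plane} (hE : ∀ p ∈ E, ∀ q ∈ E, dist p q ≤ T)
    (hB : ∀ z ∈ E, z ∈ B → z ∈ annulus cL r T ∧ z ∈ annulus cR r T) {O : Op d}
    (hO : SupportedOn (pos ⁻¹' E) O) :
    SupportedOn (above pos cL cR) O ∨ SupportedOn (above pos cL cR)ᶜ O ∨
      SupportedOn (pos ⁻¹' B)ᶜ O := by
  by_cases h1 : ∃ x, pos x ∈ E ∧ x ∈ above pos cL cR
  · by_cases h2 : ∃ y, pos y ∈ E ∧ y ∉ above pos cL cR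
    · obtain ⟨x, hxE, hx⟩ := h1
      obtain ⟨y, hyE, hy⟩ := h2
      refine Or.inr (Or.inr (hO.mono fun z hzE hzB => ?_))
      obtain ⟨hzL, hzR⟩ := hB _ hzE hzB
      exact false_of_mem_annulus_of_height hT hmin hmax hzL hzR (mem_above_iff.1 hx)
        (not_lt.1 fun h => hy (mem_above_iff.2 h)) (hE _ hzE _ hxE) (hE _ hzE _ hyE)
    · push Not at h2
      exact Or.inl (hO.mono h2)
  · push Not at h1
    exact Or.inr (Or.inl (hO.mono h1))

theorem twistPairing_groundProjector_mul {M : Set Λ} {H : Hamiltonian d} {ψ : Config d → ℂ}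
    (hψ : IsGroundState H ψ) {S B : Set Plane} {Q : Op d} (hQ : SupportedOn (pos ⁻¹' B) Q)
    (hc : ∀ j, Commute Q (H.term j))
    (hM : ∀ j, SupportedOn (pos ⁻¹' S) (H.term j) → SupportedOn M (H.term j) ∨
      SupportedOn Mᶜ (H.term j) ∨ SupportedOn (pos ⁻¹' B)ᶜ (H.term j)) (X : Op d) :
    twistPairing M ψ (groundProjector pos H S * X) Q = twistPairing M ψ X Q :=
  groundProjector_induction (fun O => twistPairing M ψ (O * X) Q = twistPairing M ψ X Q)
    (by rw [one_mul]) fun j hj O hO => by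
      rw [mul_assoc, twistPairing_mul_left hQ (hc j).symm (hM j hj)
        (H.proj j).isSelfAdjoint.star_eq (hψ j), hO]

theorem HasInteractionRange.supportedOn_above_or {H : Hamiltonian d} {w y : ℝ}
    (hw : HasInteractionRange pos H w) (hwT : w ≤ T) (hT : 8 * T < r) (hmin : r / 2 ≤ dist cL cR)
    (hmax : dist cL cR ≤ 3 * r / 2) {c : Plane} {B : Set Plane}
    (hB : ∀ z ∈ annulus c r y, z ∈ B → z ∈ annulus cL r T ∧ z ∈ annulus cR r T) (j : Fin H.size)
    (hj : SupportedOn (pos ⁻¹' annulus c r y) (H.term j)) :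
    SupportedOn (above pos cL cR) (H.term j) ∨ SupportedOn (above pos cL cR)ᶜ (H.term j) ∨
      SupportedOn (pos ⁻¹' B)ᶜ (H.term j) := by
  obtain ⟨p, hp⟩ := hw j
  -- The disk bounds the diameter of the support, and the annulus places it.
  refine TopOrder.supportedOn_above_or hT hmin hmax (E := closedBall p (w / 2) ∩ annulus c r y)
    (fun q hq q' hq' => ?_) (fun z hz hzB => hB z hz.2 hzB) (hp.inter hj)
  have h1 := mem_closedBall.1 hq.1
  have h2 := mem_closedBall.1 hq'.1
  linarith [dist_triangle_right q q' p]

/-- Null operators on the left annulus have vanishing twist pairing. -/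
theorem twistPairing_eq_zero_left {H : Hamiltonian d} {ψ : Config d → ℂ} {w y : ℝ}
    (hw : HasInteractionRange pos H w) (hψ : IsGroundState H ψ) (hwT : w ≤ T) (hyT : y ≤ T)
    (hT : 8 * T < r) (hmin : r / 2 ≤ dist cL cR) (hmax : dist cL cR ≤ 3 * r / 2) {X Q : Op d}
    (hX : groundProjector pos H (annulus cL r y) * X = 0)
    (hQ : SupportedOn (pos ⁻¹' annulus cR r T) Q) (hc : ∀ j, Commute Q (H.term j)) :
    twistPairing (above pos cL cR) ψ X Q = 0 := by
  rw [← twistPairing_groundProjector_mul hψ hQ hc (hw.supportedOn_above_or hwT hT hmin hmax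
    fun z hz hzB => ⟨annulus_mono _ _ hyT hz, hzB⟩), hX, twistPairing_zero_left]

/-- Null operators on the right annulus have vanishing twist pairing. -/
theorem twistPairing_eq_zero_right {H : Hamiltonian d} {ψ : Config d → ℂ} {w y : ℝ}
    (hw : HasInteractionRange pos H w) (hψ : IsGroundState H ψ) (hwT : w ≤ T) (hyT : y ≤ T)
    (hT : 8 * T < r) (hmin : r / 2 ≤ dist cL cR) (hmax : dist cL cR ≤ 3 * r / 2) {X P : Op d}
    (hX : groundProjector pos H (annulus cR r y) * X = 0)
    (hP : SupportedOn (pos ⁻¹' annulus cL r T) P) (hc : ∀ j, Commute P (H.term j)) :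
    twistPairing (above pos cL cR) ψ P X = 0 := by
  rw [← twistPairing_compl, ← twistPairing_groundProjector_mul hψ hP hc fun j hj => ?_, hX,
    twistPairing_zero_left]
  have h1 := hw.supportedOn_above_or hwT hT hmin hmax (B := annulus cL r T)
    (fun z hz hzB => ⟨hzB, annulus_mono _ _ hyT hz⟩) j hj
  rw [compl_compl]
  tauto

/-- The twist pairing is invariant under locality preserving unitaries. -/
theorem twistPairing_conj_eq {W : Op d} (hW : W ∈ unitary (Op d)) {R : ℝ}
    (hWR : SpreadsBy pos W R) (hR : 0 ≤ R) {t : ℝ} (ht : 0 ≤ t) (htT : t + R ≤ T)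
    (hT : 8 * T < r) (hmin : r / 2 ≤ dist cL cR)
    (hmax : dist cL cR ≤ 3 * r / 2) {P Q : Op d} (hP : SupportedOn (pos ⁻¹' annulus cL r t) P)
    (hQ : SupportedOn (pos ⁻¹' annulus cR r t) Q) (ψ : Config d → ℂ) :
    twistPairing (above pos cL cR) (W *ᵥ ψ) (W * P * star W) (W * Q * star W) =
      twistPairing (above pos cL cR) ψ P Q := by
  refine twistPairing_conj (S := pos ⁻¹' annulus cR r (t + R)) (Unitary.mem_iff.1 hW).1 hP
    (hWR.annulus hQ) (fun X hX => ?_) (fun Y hY => ?_) ψ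
  -- A site reached below the line within the evolved right annulus would lie in both annuli and
  -- near the line.
  · refine (hWR (annulus cL r t ∩ {p | 0 < height cL cR p}) X hX).mono fun z hz => ?_
    by_contra hz'
    simp only [Set.mem_union, Set.mem_compl_iff, not_or, not_not] at hz'
    obtain ⟨q, ⟨hq, hqh⟩, hzq⟩ := hz
    exact false_of_mem_annulus_of_height hT hmin hmax
      (annulus_mono _ _ htT (neighborhood_annulus_subset R cL r t ⟨q, hq, hzq⟩))
      (annulus_mono _ _ htT hz'.2) hqh (not_lt.1 hz'.1) (by linarith)
      (by rw [dist_self]; linarith)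
  · refine (hWR (annulus cL r t ∩ {p | 0 < height cL cR p}ᶜ) Y hY).mono fun z hz => ?_
    by_contra hz'
    simp only [Set.mem_union, Set.mem_compl_iff, not_or, not_not] at hz'
    obtain ⟨q, ⟨hq, hqh⟩, hzq⟩ := hz
    exact false_of_mem_annulus_of_height hT hmin hmax
      (annulus_mono _ _ htT (neighborhood_annulus_subset R cL r t ⟨q, hq, hzq⟩))
      (annulus_mono _ _ htT hz'.2) hz'.1 (not_lt.1 hqh) (by rw [dist_self]; linarith)
      (by linarith)

end TwistInvariance

/-! ### Isomorphisms of logical algebras for related ground states -/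

section Isomorphisms

variable {Λ : Type*} [Fintype Λ] [DecidableEq Λ] {d : Λ → ℕ} {pos : Λ → Plane}
  {ρ δ R : ℝ} {ψ ψ' : Config d → ℂ} {H H' : Hamiltonian d} {W : Op d} {c : Plane} {r x y : ℝ}

/-- This is the injectivity half of stability; surjectivity is
`StableLogicalAlgebra.exists_sub_mem_nullSpace`. -/
theorem StableLogicalAlgebra.mem_nullSpace {w t t' : ℝ} (h : StableLogicalAlgebra pos H c r w)
    (ht : 0 < t) (hw : 10 * w ≤ t) (htt' : t ≤ t') (ht' : t' ≤ r / 10)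
    {O : Op d} (hO : O ∈ annulusAlgebra pos H c r t) (hN : O ∈ nullSpace pos H c r w t') :
    O ∈ nullSpace pos H c r w t := by
  have h1 : inclusionMap pos H c r w htt' (toLogical pos H c r w t ⟨O, hO⟩) =
      inclusionMap pos H c r w htt' 0 := by
    rw [map_zero]
    exact Ideal.Quotient.eq_zero_iff_mem.2 hN
  exact Ideal.Quotient.eq_zero_iff_mem.1 ((h t t' htt' ht hw ht').1 h1)

theorem StableLogicalAlgebra.mem_nullSpace_of_groundProjector_mul_eq_zero {w t t' : ℝ}
    (h : StableLogicalAlgebra pos H c r w) (ht : 0 < t) (hw0 : 0 ≤ w) (hw : 10 * w ≤ t)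
    (htt' : t ≤ t') (ht' : t' ≤ r / 10) {O : Op d} (hO : O ∈ annulusAlgebra pos H c r t)
    (hN : groundProjector pos H (annulus c r t') * O = 0) : O ∈ nullSpace pos H c r w t :=
  h.mem_nullSpace ht hw htt' ht' hO <| (mem_nullSpace_iff hO.2).2 <|
    groundProjector_mul_eq_zero_of_subset (annulus_mono c r (by linarith)) hN

theorem StableLogicalAlgebra.exists_sub_mem_nullSpace {w t t' : ℝ}
    (h : StableLogicalAlgebra pos H c r w) (ht : 0 < t) (hw : 10 * w ≤ t) (htt' : t ≤ t')
    (ht' : t' ≤ r / 10) (O' : annulusAlgebra pos H c r t') :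
    ∃ O : annulusAlgebra pos H c r t, (O : Op d) - (O' : Op d) ∈ nullSpace pos H c r w t' := by
  obtain ⟨q, hq⟩ := (h t t' htt' ht hw ht').2 (toLogical pos H c r w t' O')
  obtain ⟨O, rfl⟩ := Ideal.Quotient.mk_surjective q
  exact ⟨O, toLogical_eq_iff.1 hq⟩

/-- An isomorphism of logical algebras is determined by the relation that an operator and the
conjugate by `W` of another one agree on the range of a suitable projector `p`. -/
theorem exists_starAlgEquiv_of_projector {w₁ t₁ w₂ t₂ : ℝ} (hW : W ∈ unitary (Op d)) (p : Op d)
    (hp : star p = p) (hc : ∀ O : annulusAlgebra pos H c r t₁, Commute p (W * (O : Op d) * star W))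
    (hc' : ∀ O : annulusAlgebra pos H' c r t₂, Commute p (O : Op d))
    (hpN : ∀ X ∈ nullSpace pos H' c r w₂ t₂, p * X = 0)
    (hleft : ∀ O : annulusAlgebra pos H c r t₁, ∃ O' : annulusAlgebra pos H' c r t₂,
      p * ((O' : Op d) - W * (O : Op d) * star W) = 0)
    (hright : ∀ O' : annulusAlgebra pos H' c r t₂, ∃ O : annulusAlgebra pos H c r t₁,
      p * ((O' : Op d) - W * (O : Op d) * star W) = 0)
    (hnull : ∀ (O : annulusAlgebra pos H c r t₁), (O : Op d) ∈ nullSpace pos H c r w₁ t₁ ↔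
      p * (W * (O : Op d) * star W) = 0)
    (hnull' : ∀ (O : annulusAlgebra pos H' c r t₂), p * (O : Op d) = 0 →
      (O : Op d) ∈ nullSpace pos H' c r w₂ t₂) :
    ∃ Φ : LogicalAlgebra pos H c r w₁ t₁ ≃⋆ₐ[ℂ] LogicalAlgebra pos H' c r w₂ t₂, ∀ O O',
      Φ (toLogical pos H c r w₁ t₁ O) = toLogical pos H' c r w₂ t₂ O' ↔
        p * ((O' : Op d) - W * (O : Op d) * star W) = 0 := by
  have hmul_iff : ∀ A B : Op d, p * (B - A) = 0 ↔ p * B = p * A := fun A B => by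
    rw [mul_sub, sub_eq_zero]
  obtain ⟨Φ, hΦ⟩ : ∃ Φ : LogicalAlgebra pos H c r w₁ t₁ ≃⋆ₐ[ℂ] LogicalAlgebra pos H' c r w₂ t₂,
      ∀ (O : annulusAlgebra pos H c r t₁) (O' : annulusAlgebra pos H' c r t₂),
        p * ((O' : Op d) - W * (O : Op d) * star W) = 0 →
        Φ (toLogical pos H c r w₁ t₁ O) = toLogical pos H' c r w₂ t₂ O' := by
    refine exists_logicalAlgebra_starAlgEquiv _ ?_ ?_ ?_ ?_ hleft hright ?_
    · intro a b a' b' h h'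
      simp only [hmul_iff, AddMemClass.coe_add, mul_add, add_mul] at *
      rw [h, h']
    · intro a b a' b' h h'
      simp only [hmul_iff, MulMemClass.coe_mul] at *
      rw [← conj_mul_conj hW, ← mul_assoc, h, (hc a).eq, mul_assoc, h', ← mul_assoc, ← (hc a).eq,
        mul_assoc]
    · intro z a b h
      simp only [hmul_iff, SetLike.val_smul, mul_smul_comm, smul_mul_assoc] at *
      rw [h]
    · intro a b h
      simp only [hmul_iff, StarMemClass.coe_star] at *
      rw [(hc' b).eq, (hc a).eq] at h
      have h1 := congrArg star h
      simp only [star_mul, star_star, hp] at h1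
      simpa only [mul_assoc] using h1
    · intro a b h
      rw [hmul_iff] at h
      rw [hnull a, ← h]
      exact ⟨hnull' b, fun h => hpN _ h⟩
  refine ⟨Φ, fun O O' => ⟨fun h => ?_, hΦ O O'⟩⟩
  -- For the converse, any representative `O'` of the image differs from a related `O''` by a null
  -- operator, which `p` annihilates.
  obtain ⟨O'', hO''⟩ := hleft O
  have h1 := hpN _ (toLogical_eq_iff.1 ((hΦ O O'' hO'').symm.trans h))
  rw [hmul_iff] at *
  rw [← h1, hO'']

theorem LocallyOrdered.groundProjector_mul_conj_eq_zero (hH : LocallyOrdered pos ρ δ ψ H)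
    (hH' : LocallyOrdered pos ρ δ ψ' H') (hδ : 0 < δ) (hW : W ∈ unitary (Op d))
    (hWψ : W *ᵥ ψ = ψ') (hR : 0 ≤ R) (hWR : SpreadsBy pos W R)
    (hD : closedBall c (r + r / 10) ⊆ closedBall 0 ρ) (hxy : x + R + 2 * δ ≤ y)
    (hy : y ≤ r / 10) {A : Op d} (hA : groundProjector pos H (annulus c r x) * A = 0) :
    groundProjector pos H' (annulus c r y) * (W * A * star W) = 0 := by
  rw [← hH.groundProjector_mul_conj hH' hδ hW hWψ hR hWR hD hxy hy, mul_assoc, conj_mul_conj hW,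
    hA, mul_zero, zero_mul, mul_zero]

/-- An operator of the annulus algebra of `H`, evolved by `W` and projected onto the states without
excitations of `H'`, belongs to the annulus algebra of `H'`. -/
theorem LocallyOrdered.groundProjector_mul_conj_mem (hH : LocallyOrdered pos ρ δ ψ H)
    (hH' : LocallyOrdered pos ρ δ ψ' H') (hδ : 0 < δ) (hW : W ∈ unitary (Op d))
    (hWψ : W *ᵥ ψ = ψ') (hR : 0 ≤ R) (hWR : SpreadsBy pos W R)
    (hD : closedBall c (r + r / 10) ⊆ closedBall 0 ρ) (hxy : x + 3 * R + 3 * δ ≤ y)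
    (hy : y ≤ r / 10) (O : annulusAlgebra pos H c r x) :
    groundProjector pos H' (annulus c r y) * (W * (O : Op d) * star W) ∈
      annulusAlgebra pos H' c r y := by
  have hO := hWR.annulus O.2.1
  have hcomm := hH.commute_groundProjector_conj hH' hδ hW hWψ hR hWR hD hxy hy O
  refine ⟨supportedOn_groundProjector.mul
    (hO.mono (Set.preimage_mono (annulus_mono c r (by linarith)))), fun j => ?_⟩
  -- A term off the evolved operator commutes with both factors; any other term lies in the larger
  -- annulus and is absorbed by the projector from either side.
  rcases hH'.range.supportedOn_compl_or (annulus c r (x + R)) j with h | ⟨p, z, hz, hzp, hp⟩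
  · refine (term_commute_groundProjector j).symm.mul_left ?_
    exact (h.commute hO (Set.disjoint_left.2 fun _ h h' => h h')).symm
  · have hj : SupportedOn (pos ⁻¹' annulus c r y) (H'.term j) :=
      hp.mono (Set.preimage_mono (closedBall_subset_annulus hz hzp (by linarith)))
    change _ * _ = _ * _
    rw [← mul_assoc (H'.term j), term_mul_groundProjector hj, hcomm.eq, mul_assoc,
      groundProjector_mul_term hj]

/-- The logical algebras of two Hamiltonians, whose ground states are related by a locality
preserving unitary, are isomorphic. -/
theorem LocallyOrdered.exists_starAlgEquiv (hH : LocallyOrdered pos ρ δ ψ H)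
    (hH' : LocallyOrdered pos ρ δ ψ' H') (hδ : 0 < δ) (hW : W ∈ unitary (Op d))
    (hWψ : W *ᵥ ψ = ψ') (hR : 0 ≤ R) (hWR : SpreadsBy pos W R)
    (hD : closedBall c (r + r / 10) ⊆ closedBall 0 ρ) {w w' t : ℝ} (hw0 : 0 ≤ w)
    (hw : w ≤ δ) (hw'0 : 0 ≤ w') (hw' : w' ≤ δ) (hwt : 10 * δ ≤ t) (hstab : StableLogicalAlgebra pos H c r w)
    (hstab' : StableLogicalAlgebra pos H' c r w') (htr : t + 4 * R + 6 * δ ≤ r / 10) :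
    ∃ Φ : LogicalAlgebra pos H c r w t ≃⋆ₐ[ℂ] LogicalAlgebra pos H' c r w' t, ∀ O O',
      Φ (toLogical pos H c r w t O) = toLogical pos H' c r w' t O' ↔
        groundProjector pos H' (annulus c r (t + 3 * R + 4 * δ)) *
          ((O' : Op d) - W * (O : Op d) * star W) = 0 := by
  have hψψ' : star W *ᵥ ψ' = ψ := by
    rw [← hWψ, Matrix.mulVec_mulVec, (Unitary.mem_iff.1 hW).1, Matrix.one_mulVec]
  have hW' := Unitary.star_mem hW
  have hWR' := hWR.star hW
  have ht : 0 < t := by linarith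
  -- This is the thickness at which evolved operators enter the algebra of `H'`. The projector of
  -- the relation has thickness `y₁ + δ`, enough to annihilate the null operators at `y₁`.
  set y₁ := t + 3 * R + 3 * δ with hy₁
  have hmono : ∀ {a b : ℝ}, a ≤ b → annulus c r a ⊆ annulus c r b := fun h => annulus_mono c r h
  refine exists_starAlgEquiv_of_projector hW _ star_groundProjector (fun O => ?_) (fun O => ?_)
    (fun X hX => ?_) (fun O => ?_) (fun O' => ?_) (fun O => ⟨fun hO => ?_, fun hO => ?_⟩)
    (fun O' hO' => ?_)
  · exact hH.commute_groundProjector_conj hH' hδ hW hWψ hR hWR hD (by linarith) (by linarith) O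
  · exact (commute_groundProjector fun j _ => O.2.2 j).symm
  · exact groundProjector_mul_eq_zero_of_subset (hmono (by linarith))
      (groundProjector_mul_eq_zero_of_mem_nullSpace hX)
  · obtain ⟨O', hO'⟩ := hstab'.exists_sub_mem_nullSpace ht (by linarith) (by linarith)
      (by linarith) ⟨_, hH.groundProjector_mul_conj_mem hH' hδ hW hWψ hR hWR hD (x := t) (y := y₁)
        le_rfl (by linarith) O⟩
    refine ⟨O', ?_⟩
    have h1 := groundProjector_mul_eq_zero_of_subset (hmono (by linarith : y₁ + w' ≤
      t + 3 * R + 4 * δ)) (groundProjector_mul_eq_zero_of_mem_nullSpace hO')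
    rwa [mul_sub, ← mul_assoc _ (groundProjector _ _ _),
      mul_groundProjector_of_subset (hmono (by linarith)), ← mul_sub] at h1
  · have hO₁ := hH'.groundProjector_mul_conj_mem hH hδ hW' hψψ' hR hWR' hD (x := t) (y := y₁)
      le_rfl (by linarith) O'
    rw [star_star] at hO₁
    obtain ⟨O, hO⟩ := hstab.exists_sub_mem_nullSpace ht (by linarith) (by linarith)
      (by linarith) ⟨_, hO₁⟩
    refine ⟨O, ?_⟩
    have h1 := groundProjector_mul_eq_zero_of_subset (hmono (by linarith : y₁ + w ≤
      y₁ + δ)) (groundProjector_mul_eq_zero_of_mem_nullSpace hO)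
    rw [mul_sub, ← mul_assoc _ (groundProjector _ _ _),
      mul_groundProjector_of_subset (hmono (by linarith)), ← mul_sub] at h1
    -- Pulling back and pushing forward proves the relation only for the larger thickness `(y₁ + δ)
    -- + R + 2 δ = t + 4 R + 6 δ`. Stability of `H'`, applied to the difference in its algebra at
    -- `y₁`, brings it down to `y₁ + δ`.
    have h2 := hH.groundProjector_mul_conj_eq_zero hH' hδ hW hWψ hR hWR hD
      (y := t + 4 * R + 6 * δ) (by linarith) htr h1
    rw [mul_sub W, sub_mul, conj_star_conj hW] at h2
    have hF := hH.groundProjector_mul_conj_mem hH' hδ hW hWψ hR hWR hD (x := t) (y := y₁)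
      le_rfl (by linarith) O
    have hsub : (O' : Op d) - groundProjector pos H' (annulus c r y₁) *
        (W * (O : Op d) * star W) ∈ annulusAlgebra pos H' c r y₁ :=
      sub_mem (annulusInclusion pos H' c r (by linarith : t ≤ y₁) O').2 hF
    have h3 := hstab'.mem_nullSpace_of_groundProjector_mul_eq_zero (by linarith) hw'0
      (by linarith) (by linarith : y₁ ≤ t + 4 * R + 6 * δ) htr hsub (by
        rw [mul_sub, ← mul_assoc _ (groundProjector _ _ _),
          mul_groundProjector_of_subset (hmono (by linarith)), ← mul_sub, ← neg_sub, mul_neg, h2,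
          neg_zero])
    have h4 := groundProjector_mul_eq_zero_of_subset (hmono (by linarith : y₁ + w' ≤
      t + 3 * R + 4 * δ)) (groundProjector_mul_eq_zero_of_mem_nullSpace h3)
    rwa [mul_sub, ← mul_assoc _ (groundProjector _ _ _),
      mul_groundProjector_of_subset (hmono (by linarith)), ← mul_sub] at h4
  · refine hH.groundProjector_mul_conj_eq_zero hH' hδ hW hWψ hR hWR hD (x := t + w)
      (by linarith) (by linarith) (groundProjector_mul_eq_zero_of_mem_nullSpace hO)
  · have h1 := hH'.groundProjector_mul_conj_eq_zero hH hδ hW' hψψ' hR hWR' hD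
      (y := t + 4 * R + 6 * δ) (by linarith) htr hO
    rw [star_star, star_conj_conj hW] at h1
    exact hstab.mem_nullSpace_of_groundProjector_mul_eq_zero ht hw0 (by linarith) (by linarith)
      htr O.2 h1
  · exact hstab'.mem_nullSpace_of_groundProjector_mul_eq_zero ht hw'0 (by linarith) (by linarith)
      (by linarith) O'.2 hO'

end Isomorphisms

/-! ### The evolved Hamiltonian -/

section Evolution

variable {Λ : Type*} [Fintype Λ] [DecidableEq Λ] {d : Λ → ℕ} {pos : Λ → Plane}
  {R : ℝ} {ψ : Config d → ℂ} {H : Hamiltonian d} {W : Op d} {c : Plane} {r : ℝ}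

theorem IsGroundState.evolve (hψ : IsGroundState H ψ) (hW : W ∈ unitary (Op d)) :
    IsGroundState (H.evolve hW) (W *ᵥ ψ) := fun j => by
  change (W * H.term j * star W) *ᵥ (W *ᵥ ψ) = _
  rw [Matrix.mulVec_mulVec, mul_assoc, (Unitary.mem_iff.1 hW).1, mul_one, ← Matrix.mulVec_mulVec,
    hψ j]

theorem HasInteractionRange.evolve {w : ℝ} (hw : HasInteractionRange pos H w)
    (hW : W ∈ unitary (Op d)) (hWR : SpreadsBy pos W R) :
    HasInteractionRange pos (H.evolve hW) (w + 2 * R) := fun j => by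
  obtain ⟨p, hp⟩ := hw j
  refine ⟨p, ?_⟩
  rw [show (w + 2 * R) / 2 = w / 2 + R by ring]
  exact hWR.closedBall hp

theorem conj_mem_nullSpace_evolve (hW : W ∈ unitary (Op d)) (hWR : SpreadsBy pos W R)
    {w t w' t' : ℝ} (h : t + w + R ≤ t' + w') {X : Op d} (hX : X ∈ nullSpace pos H c r w t) :
    W * X * star W ∈ nullSpace pos (H.evolve hW) c r w' t' := by
  refine Submodule.span_induction
    (p := fun X _ => W * X * star W ∈ nullSpace pos (H.evolve hW) c r w' t') ?_ ?_ ?_ ?_ hX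
  · rintro X ⟨j, hj, h1, h2⟩
    refine Submodule.subset_span ⟨j, (hWR.annulus hj).mono (Set.preimage_mono
      (annulus_mono c r h)), ?_, ?_⟩
    · change W * H.term j * star W * _ = 0
      rw [conj_mul_conj hW, h1, mul_zero, zero_mul]
    · change _ * (W * H.term j * star W) = 0
      rw [conj_mul_conj hW, h2, mul_zero, zero_mul]
  · simp
  · intro X Y _ _ h1 h2
    rw [mul_add, add_mul]
    exact add_mem h1 h2
  · intro z X _ h1
    rw [mul_smul_comm, smul_mul_assoc]
    exact Submodule.smul_mem _ _ h1

theorem mem_nullSpace_of_conj_mem (hW : W ∈ unitary (Op d)) (hWR : SpreadsBy pos W R)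
    {w t w' t' : ℝ} (h : t + w + R ≤ t' + w') {X : Op d}
    (hX : X ∈ nullSpace pos (H.evolve hW) c r w t) :
    star W * X * W ∈ nullSpace pos H c r w' t' := by
  refine Submodule.span_induction
    (p := fun X _ => star W * X * W ∈ nullSpace pos H c r w' t') ?_ ?_ ?_ ?_ hX
  · rintro X ⟨j, hj, h1, h2⟩
    have hterm : (H.evolve hW).term j = W * H.term j * star W := rfl
    rw [hterm] at hj h1 h2
    have hj' := ((hWR.star hW).annulus hj).mono (Set.preimage_mono (annulus_mono c r h))
    rw [star_star, star_conj_conj hW] at hj'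
    refine Submodule.subset_span ⟨j, hj', conj_injective hW ?_, conj_injective hW ?_⟩
    · rw [← conj_mul_conj hW, conj_star_conj hW, h1, mul_zero, zero_mul]
    · rw [← conj_mul_conj hW, conj_star_conj hW, h2, mul_zero, zero_mul]
  · simp
  · intro X Y _ _ h1 h2
    rw [mul_add, add_mul]
    exact add_mem h1 h2
  · intro z X _ h1
    rw [mul_smul_comm, smul_mul_assoc]
    exact Submodule.smul_mem _ _ h1

theorem conj_mem_annulusAlgebra_evolve (hW : W ∈ unitary (Op d)) (hWR : SpreadsBy pos W R) {t : ℝ}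
    (O : annulusAlgebra pos H c r t) :
    W * (O : Op d) * star W ∈ annulusAlgebra pos (H.evolve hW) c r (t + R) :=
  ⟨hWR.annulus O.2.1, fun j => Commute.conj hW (O.2.2 j)⟩

theorem star_conj_mem_annulusAlgebra (hW : W ∈ unitary (Op d)) (hWR : SpreadsBy pos W R) {t : ℝ}
    (O : annulusAlgebra pos (H.evolve hW) c r t) :
    star W * (O : Op d) * W ∈ annulusAlgebra pos H c r (t + R) := by
  refine ⟨?_, fun j => ?_⟩
  · have h := (hWR.star hW).annulus O.2.1
    rwa [star_star] at h
  · have h := Commute.conj (Unitary.star_mem hW) (O.2.2 j)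
    rwa [star_star, show (H.evolve hW).term j = W * H.term j * star W from rfl,
      star_conj_conj hW] at h

/-- Conjugation by `W` induces an isomorphism of the logical algebras of `H` and of the evolved
Hamiltonian `W H W†`. -/
theorem exists_starAlgEquiv_evolve (hW : W ∈ unitary (Op d)) (hR : 0 ≤ R)
    (hWR : SpreadsBy pos W R) {w t : ℝ} (ht : 0 < t) (hwt : 10 * w ≤ t)
    (hstab : StableLogicalAlgebra pos H c r w) (htr : t + 4 * R ≤ r / 10) :
    ∃ Φ : LogicalAlgebra pos H c r w t ≃⋆ₐ[ℂ]
        LogicalAlgebra pos (H.evolve hW) c r (w + 2 * R) (t + R), ∀ O O',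
      Φ (toLogical pos H c r w t O) = toLogical pos (H.evolve hW) c r (w + 2 * R) (t + R) O' ↔
        groundProjector pos (H.evolve hW) (annulus c r (t + R + (w + 2 * R))) *
          ((O' : Op d) - W * (O : Op d) * star W) = 0 := by
  have hmem := fun O : annulusAlgebra pos H c r t => conj_mem_annulusAlgebra_evolve hW hWR O
  refine exists_starAlgEquiv_of_projector hW _ star_groundProjector
    (fun O => (commute_groundProjector fun j _ => (hmem O).2 j).symm)
    (fun O => (commute_groundProjector fun j _ => O.2.2 j).symm)
    (fun X hX => groundProjector_mul_eq_zero_of_mem_nullSpace hX)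
    (fun O => ⟨⟨_, hmem O⟩, by rw [sub_self, mul_zero]⟩) (fun O' => ?_)
    (fun O => ⟨fun hO => ?_, fun hO => ?_⟩) (fun O' hO' => (mem_nullSpace_iff O'.2.2).2 hO')
  -- The pulled back operator has thickness `t + 2 R`. The null error from shrinking it involves
  -- terms up to `t + 2 R + w`, and conjugation takes these to exactly `(t + R) + (w + 2 R)`.
  · obtain ⟨O, hO⟩ := hstab.exists_sub_mem_nullSpace ht hwt (by linarith : t ≤ t + R + R)
      (by linarith) ⟨_, star_conj_mem_annulusAlgebra hW hWR O'⟩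
    refine ⟨O, ?_⟩
    have h1 := groundProjector_mul_eq_zero_of_mem_nullSpace (conj_mem_nullSpace_evolve hW hWR
      (by linarith : t + R + R + w + R ≤ t + R + (w + 2 * R)) hO)
    rw [mul_sub W, sub_mul, conj_star_conj hW] at h1
    rw [← neg_sub, mul_neg, h1, neg_zero]
  · exact groundProjector_mul_eq_zero_of_mem_nullSpace
      (conj_mem_nullSpace_evolve hW hWR (by linarith) hO)
  · have h1 := mem_nullSpace_of_conj_mem hW hWR
      (by linarith : t + R + (w + 2 * R) + R ≤ t + 4 * R + w) ((mem_nullSpace_iff (hmem O).2).2 hO)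
    rw [star_conj_conj hW] at h1
    exact hstab.mem_nullSpace ht hwt (by linarith) htr O.2 h1

end Evolution

/-! ### Twist pairings of corresponding classes and the theorem -/

section Main

variable {Λ : Type*} [Fintype Λ] [DecidableEq Λ] {d : Λ → ℕ} {pos : Λ → Plane}
  {ψ : Config d → ℂ} {H H' : Hamiltonian d} {W : Op d} {cL cR : Plane} {ρ r t R w w' : ℝ}

theorem twistPairing_sub_right (M : Set Λ) (ψ : Config d → ℂ) (P Q Q' : Op d) :
    twistPairing M ψ P (Q - Q') = twistPairing M ψ P Q - twistPairing M ψ P Q' := by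
  simp only [← twistPairing_compl M, twistPairing_sub_left]

theorem Admissible.locallyOrdered (h : Admissible pos ρ r cL cR ψ H w) (hψ : star ψ ⬝ᵥ ψ = 1)
    {δ : ℝ} (hw : w ≤ δ) : LocallyOrdered pos ρ δ ψ H where
  range := h.range.mono hw
  ground := h.ground
  lto := h.lto
  ne_zero := by
    rintro rfl
    simp at hψ

/-- Admissible Hamiltonians for two states related by a locality preserving unitary have isomorphic
logical algebras, with the same twist pairing. -/
theorem Admissible.exists_preservesTwistPairing (hψ : star ψ ⬝ᵥ ψ = 1) (ht : 60 * t < r)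
    (hmin : r / 2 ≤ dist cL cR) (hmax : dist cL cR ≤ 3 * r / 2)
    (hL : closedBall cL (r + r / 10) ⊆ closedBall 0 ρ)
    (hR : closedBall cR (r + r / 10) ⊆ closedBall 0 ρ) (hW : W ∈ unitary (Op d)) (hR0 : 0 ≤ R)
    (hRt : R < t) (hWR : SpreadsBy pos W R) (hw : 1200 * w < 60 * t) (hw' : 1200 * w' < 60 * t)
    (hH : Admissible pos ρ r cL cR ψ H w) (hH' : Admissible pos ρ r cL cR (W *ᵥ ψ) H' w') :
    ∃ (ΦL : LogicalAlgebra pos H cL r w t ≃⋆ₐ[ℂ] LogicalAlgebra pos H' cL r w' t)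
      (ΦR : LogicalAlgebra pos H cR r w t ≃⋆ₐ[ℂ] LogicalAlgebra pos H' cR r w' t),
      PreservesTwistPairing pos r cL cR ψ (W *ᵥ ψ) ΦL ΦR := by
  have hw0 := hH.range_nonneg
  have hw'0 := hH'.range_nonneg
  -- The common range `δ = t / 20` exceeds `w` and `w'`. Then `t + 4 R + 6 δ ≤ 5.3 t`, which is
  -- below `r / 10` since `60 t < r`.
  have hδ : 0 < t / 20 := by linarith
  have hψ' : star (W *ᵥ ψ) ⬝ᵥ (W *ᵥ ψ) = 1 := by
    rw [Matrix.star_mulVec, ← Matrix.dotProduct_mulVec, Matrix.mulVec_mulVec,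
      ← Matrix.star_eq_conjTranspose, (Unitary.mem_iff.1 hW).1, Matrix.one_mulVec, hψ]
  have hψψ' : star W *ᵥ (W *ᵥ ψ) = ψ := by
    rw [Matrix.mulVec_mulVec, (Unitary.mem_iff.1 hW).1, Matrix.one_mulVec]
  have hO := hH.locallyOrdered hψ (by linarith : w ≤ t / 20)
  have hO' := hH'.locallyOrdered hψ' (by linarith : w' ≤ t / 20)
  obtain ⟨ΦL, hΦL⟩ := hO.exists_starAlgEquiv hO' hδ hW rfl hR0 hWR hL hw0 (by linarith) hw'0
    (by linarith) (by linarith : 10 * (t / 20) ≤ t) hH.stableL hH'.stableL (by linarith)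
  obtain ⟨ΦR, hΦR⟩ := hO.exists_starAlgEquiv hO' hδ hW rfl hR0 hWR hR hw0 (by linarith) hw'0
    (by linarith) (by linarith : 10 * (t / 20) ≤ t) hH.stableR hH'.stableR (by linarith)
  refine ⟨ΦL, ΦR, fun P₁ P₂ Q₁ Q₂ hP hQ => ?_⟩
  rw [hΦL] at hP
  rw [hΦR] at hQ
  have hT : 8 * (6 * t) < r := by linarith
  have hP' := hO'.groundProjector_mul_conj_eq_zero hO hδ (Unitary.star_mem hW) hψψ' hR0
    (hWR.star hW) hL (y := t + 4 * R + 6 * (t / 20)) (by linarith) (by linarith) hP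
  have hP₂ := (hWR.star hW).annulus P₂.2.1
  rw [star_star] at hP' hP₂
  rw [mul_sub (star W), sub_mul, star_conj_conj hW] at hP'
  -- Null differences pair to zero only with operators commuting with the same Hamiltonian. So `P₁`
  -- is replaced by `W† P₂ W` against `Q₁` in `ψ`, the pair is conjugated by `W`, and `W Q₁ W†` is
  -- replaced by `Q₂` against `P₂` in `W ψ`.
  have h1 := twistPairing_eq_zero_left hO.range hO.ground (T := 6 * t) (by linarith) (by linarith)
    hT hmin hmax hP' (Q₁.2.1.mono (Set.preimage_mono (annulus_mono cR r (by linarith)))) Q₁.2.2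
  have h2 := twistPairing_eq_zero_right hO'.range hO'.ground (T := 6 * t) (by linarith)
    (by linarith) hT hmin hmax hQ
    (P₂.2.1.mono (Set.preimage_mono (annulus_mono cL r (by linarith)))) P₂.2.2
  have h3 := twistPairing_conj_eq hW hWR hR0 (by linarith) (by linarith : t + R + R ≤ 6 * t) hT
    hmin hmax hP₂ (Q₁.2.1.mono (Set.preimage_mono (annulus_mono cR r (by linarith)))) ψ
  rw [conj_star_conj hW] at h3
  rw [twistPairing_sub_left, sub_eq_zero] at h1
  rw [twistPairing_sub_right, sub_eq_zero] at h2
  rw [← h1, ← h3, ← h2]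

/-- Conjugation by a locality preserving unitary `W` preserves the logical algebras and the twist
pairing. -/
theorem Admissible.exists_preservesTwistPairing_evolve (ht : 60 * t < r)
    (hmin : r / 2 ≤ dist cL cR) (hmax : dist cL cR ≤ 3 * r / 2) (hW : W ∈ unitary (Op d))
    (hR0 : 0 ≤ R) (hRt : R < t) (hWR : SpreadsBy pos W R) (hw : 1200 * w < 60 * t)
    (hH : Admissible pos ρ r cL cR ψ H w) :
    ∃ (ΦL : LogicalAlgebra pos H cL r w t ≃⋆ₐ[ℂ]
        LogicalAlgebra pos (H.evolve hW) cL r (w + 2 * R) (t + R))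
      (ΦR : LogicalAlgebra pos H cR r w t ≃⋆ₐ[ℂ]
        LogicalAlgebra pos (H.evolve hW) cR r (w + 2 * R) (t + R)),
      (∀ O : annulusAlgebra pos H cL r t,
        ∃ O' : annulusAlgebra pos (H.evolve hW) cL r (t + R),
          (O' : Op d) = W * (O : Op d) * star W ∧
          ΦL (toLogical pos H cL r w t O) =
            toLogical pos (H.evolve hW) cL r (w + 2 * R) (t + R) O') ∧
      (∀ O : annulusAlgebra pos H cR r t,
        ∃ O' : annulusAlgebra pos (H.evolve hW) cR r (t + R),
          (O' : Op d) = W * (O : Op d) * star W ∧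
          ΦR (toLogical pos H cR r w t O) =
            toLogical pos (H.evolve hW) cR r (w + 2 * R) (t + R) O') ∧
      PreservesTwistPairing pos r cL cR ψ (W *ᵥ ψ) ΦL ΦR := by
  have hw0 := hH.range_nonneg
  have ht0 : 0 < t := by linarith
  obtain ⟨ΦL, hΦL⟩ := exists_starAlgEquiv_evolve hW hR0 hWR ht0 (by linarith) hH.stableL
    (by linarith)
  obtain ⟨ΦR, hΦR⟩ := exists_starAlgEquiv_evolve hW hR0 hWR ht0 (by linarith) hH.stableR
    (by linarith)
  refine ⟨ΦL, ΦR, fun O => ⟨⟨_, conj_mem_annulusAlgebra_evolve hW hWR O⟩, rfl,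
    (hΦL _ _).2 (by rw [sub_self, mul_zero])⟩, fun O => ⟨⟨_, conj_mem_annulusAlgebra_evolve hW hWR O⟩,
    rfl, (hΦR _ _).2 (by rw [sub_self, mul_zero])⟩, fun P₁ P₂ Q₁ Q₂ hP hQ => ?_⟩
  rw [hΦL] at hP
  rw [hΦR] at hQ
  have hT : 8 * (6 * t) < r := by linarith
  have hrange := hH.range.evolve hW hWR
  have hground := hH.ground.evolve hW
  have hP₁ := conj_mem_annulusAlgebra_evolve hW hWR P₁
  -- Here `W P₁ W†` commutes with the evolved Hamiltonian, so both replacements take place in `W ψ`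
  -- before conjugating back.
  have h1 := twistPairing_eq_zero_left hrange hground (T := 6 * t) (by linarith) (by linarith)
    hT hmin hmax hP (Q₂.2.1.mono (Set.preimage_mono (annulus_mono cR r (by linarith)))) Q₂.2.2
  have h2 := twistPairing_eq_zero_right hrange hground (T := 6 * t) (by linarith)
    (by linarith) hT hmin hmax hQ
    (hP₁.1.mono (Set.preimage_mono (annulus_mono cL r (by linarith)))) hP₁.2
  rw [twistPairing_sub_left, sub_eq_zero] at h1
  rw [twistPairing_sub_right, sub_eq_zero] at h2
  rw [h1, h2, twistPairing_conj_eq hW hWR hR0 ht0.le (by linarith : t + R ≤ 6 * t) hT hmin hmax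
    P₁.2.1 Q₁.2.1]

end Main

end TopOrder

theorem mainTheorem1 {Λ : Type*} [Fintype Λ] [DecidableEq Λ] (pos : Λ → Plane) (d : Λ → ℕ)
    (ψ : Config d → ℂ) (hψ : star ψ ⬝ᵥ ψ = 1)
    (L ρ r t : ℝ) (hρ : L < ρ) (hr : r < L) (ht : 60 * t < r)
    (cL cR : Plane) (hmin : r / 2 ≤ dist cL cR) (hmax : dist cL cR ≤ 3 * r / 2)
    (hL : Metric.closedBall cL (r + r / 10) ⊆ Metric.closedBall 0 ρ)
    (hR : Metric.closedBall cR (r + r / 10) ⊆ Metric.closedBall 0 ρ) :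
    -- the logical algebra, its twist pairing and the S-matrix depend only on the state
    (∀ (H₁ H₂ : Hamiltonian d) (w₁ w₂ : ℝ), 1200 * w₁ < 60 * t → 1200 * w₂ < 60 * t →
      Admissible pos ρ r cL cR ψ H₁ w₁ → Admissible pos ρ r cL cR ψ H₂ w₂ →
      (∃ (ΦL : LogicalAlgebra pos H₁ cL r w₁ t ≃⋆ₐ[ℂ] LogicalAlgebra pos H₂ cL r w₂ t)
        (ΦR : LogicalAlgebra pos H₁ cR r w₁ t ≃⋆ₐ[ℂ] LogicalAlgebra pos H₂ cR r w₂ t),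
        PreservesTwistPairing pos r cL cR ψ ψ ΦL ΦR) ∧
      EqUpToPermutation (sTilde pos r cL cR ψ H₁ w₁ t) (sTilde pos r cL cR ψ H₂ w₂ t)) ∧
    -- invariance under a quantum circuit `W` of range `R < t`
    (∀ (W : Op d) (hW : IsQuantumCircuit pos W) (R : ℝ), HasCircuitRange pos W R → R < t →
      ∀ (H : Hamiltonian d) (w : ℝ), 1200 * w < 60 * t → Admissible pos ρ r cL cR ψ H w →
      -- for the logical algebra computed from any Hamiltonian as above for the state `W ψ`
      (∀ (H' : Hamiltonian d) (w' : ℝ), 1200 * w' < 60 * t →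
        Admissible pos ρ r cL cR (W *ᵥ ψ) H' w' →
        (∃ (ΦL : LogicalAlgebra pos H cL r w t ≃⋆ₐ[ℂ] LogicalAlgebra pos H' cL r w' t)
          (ΦR : LogicalAlgebra pos H cR r w t ≃⋆ₐ[ℂ] LogicalAlgebra pos H' cR r w' t),
          PreservesTwistPairing pos r cL cR ψ (W *ᵥ ψ) ΦL ΦR) ∧
        EqUpToPermutation (sTilde pos r cL cR ψ H w t)
          (sTilde pos r cL cR (W *ᵥ ψ) H' w' t)) ∧
      -- for the logical algebra computed from the evolved Hamiltonian `W H W†`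
      (IsGroundState (H.evolve hW.mem_unitary) (W *ᵥ ψ) ∧
        HasInteractionRange pos (H.evolve hW.mem_unitary) (w + 2 * R) ∧
        (∃ (ΦL : LogicalAlgebra pos H cL r w t ≃⋆ₐ[ℂ]
            LogicalAlgebra pos (H.evolve hW.mem_unitary) cL r (w + 2 * R) (t + R))
          (ΦR : LogicalAlgebra pos H cR r w t ≃⋆ₐ[ℂ]
            LogicalAlgebra pos (H.evolve hW.mem_unitary) cR r (w + 2 * R) (t + R)),
          (∀ O : annulusAlgebra pos H cL r t,
            ∃ O' : annulusAlgebra pos (H.evolve hW.mem_unitary) cL r (t + R),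
              (O' : Op d) = W * (O : Op d) * star W ∧
              ΦL (toLogical pos H cL r w t O) =
                toLogical pos (H.evolve hW.mem_unitary) cL r (w + 2 * R) (t + R) O') ∧
          (∀ O : annulusAlgebra pos H cR r t,
            ∃ O' : annulusAlgebra pos (H.evolve hW.mem_unitary) cR r (t + R),
              (O' : Op d) = W * (O : Op d) * star W ∧
              ΦR (toLogical pos H cR r w t O) =
                toLogical pos (H.evolve hW.mem_unitary) cR r (w + 2 * R) (t + R) O') ∧
          PreservesTwistPairing pos r cL cR ψ (W *ᵥ ψ) ΦL ΦR) ∧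
        EqUpToPermutation (sTilde pos r cL cR ψ H w t)
          (sTilde pos r cL cR (W *ᵥ ψ) (H.evolve hW.mem_unitary) (w + 2 * R) (t + R)))) := by
  have key : ∀ (W : Op d) (hW : IsQuantumCircuit pos W) (R : ℝ), HasCircuitRange pos W R → R < t →
      ∀ (H : Hamiltonian d) (w : ℝ), 1200 * w < 60 * t → Admissible pos ρ r cL cR ψ H w →
      ∀ (H' : Hamiltonian d) (w' : ℝ), 1200 * w' < 60 * t →
        Admissible pos ρ r cL cR (W *ᵥ ψ) H' w' →
        (∃ (ΦL : LogicalAlgebra pos H cL r w t ≃⋆ₐ[ℂ] LogicalAlgebra pos H' cL r w' t)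
          (ΦR : LogicalAlgebra pos H cR r w t ≃⋆ₐ[ℂ] LogicalAlgebra pos H' cR r w' t),
          PreservesTwistPairing pos r cL cR ψ (W *ᵥ ψ) ΦL ΦR) ∧
        EqUpToPermutation (sTilde pos r cL cR ψ H w t)
          (sTilde pos r cL cR (W *ᵥ ψ) H' w' t) := by
    intro W hW R hWR hRt H w hw hH H' w' hw' hH'
    obtain ⟨ΦL, ΦR, hΦ⟩ := hH.exists_preservesTwistPairing hψ ht hmin hmax hL hR hW.mem_unitary
      hWR.1 hRt (hWR.spreadsBy hW.mem_unitary) hw hw' hH'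
    exact ⟨⟨ΦL, ΦR, hΦ⟩, hΦ.eqUpToPermutation⟩
  refine ⟨fun H₁ H₂ w₁ w₂ hw₁ hw₂ h₁ h₂ => ?_, fun W hW R hWR hRt H w hw hH =>
    ⟨key W hW R hWR hRt H w hw hH, hH.ground.evolve _,
      hH.range.evolve _ (hWR.spreadsBy hW.mem_unitary), ?_⟩⟩
  -- Two Hamiltonians for the same state are related by the empty circuit, of range `0`; `0 < t`
  -- follows from `0 ≤ w₁`.
  · have h := key 1 ⟨[], by simp, rfl⟩ 0 ⟨le_rfl, fun c s O hO => by simpa using hO⟩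
      (by linarith [h₁.range_nonneg]) H₁ w₁ hw₁ h₁ H₂ w₂ hw₂
    rw [Matrix.one_mulVec] at h
    exact h h₂
  · obtain ⟨ΦL, ΦR, hL, hR, hΦ⟩ := hH.exists_preservesTwistPairing_evolve ht hmin hmax
      hW.mem_unitary hWR.1 hRt (hWR.spreadsBy hW.mem_unitary) hw
    exact ⟨⟨ΦL, ΦR, hL, hR, hΦ⟩, hΦ.eqUpToPermutation⟩
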